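/- Fix a field $K$ (for instance $K=\mathbb C$), $q\in K$, integers $n,m\ge 0$, sequences $\Xi=(\xi_0,\xi_1,\dots)$, ${\sf S}=(s_0,s_1,\dots)$ in $K$ with chosen square roots $\sqrt{\xi_i},\sqrt{s_i}\in K$, and $\kappa_1,\dots,\kappa_n,u_1,\dots,u_m\in K$. Assume the parameters are generic in the sense that: $q^k\ne1$ for $k\ge1$; $\xi_i,s_i\neq 0$ for $i\ge0$; $\frac{s_{i+j}\xi_{i+j}s_j}{\xi_j}\,q^k\ne1$ for $0\le i\le n$, $j\ge1$, $k\ge0$; and $u_j\xi_is_i\ne1$ for $1\le j\le m$, $i\ge1$. **Notation.** $(x;q)_a=\prod_{r=0}^{a-1}(1-xq^r)$. For a partition $\lambda=(\lambda_1\ge\lambda_2\ge\dots)$, $\lambda'$ is its conjugate, $l(\lambda)$ its length, $m_j(\lambda')=\lambda_j-\lambda_{j+1}$. Put $$\xi_i^{(k)}=\frac{\sqrt{\xi_{i+k}}\sqrt{s_{i+k}}\sqrt{\xi_i}}{\sqrt{s_i}},\quad s_i^{(k)}=\frac{\sqrt{s_{i+k}}\sqrt{\xi_{i+k}}\sqrt{s_i}}{\sqrt{\xi_i}},\quad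 \tau^k_{\sf S}\Xi=(\xi^{(k)}_i)_{i\ge0},\quad \tau^k_\Xi{\sf S}=(s^{(k)}_i)_{i\ge0},$$ $${\sf c}_{\sf S}(\lambda)=\prod_{i\ge1}\frac{(s_i^2;q)_{\lambda_i-\lambda_{i+1}}}{(q;q)_{\lambda_i-\lambda_{i+1}}},\qquad (-{\sf S})^\lambda=\prod_{i\ge1}(-s_{i-1})^{\lambda_i}.$$ **Vertex weights** for the labels $i,j$ of the incoming bottom and left edges and $k,l$ of the outgoing top and right edges (nonnegative integers): $$W_{t,s}(i,j;k,l)=\mathbf 1_{i+j=k+l}\mathbf 1_{i\ge l}\,\frac{s^{2l}}{t^{2l}}\,\frac{(s^2/t^2;q)_{i-l}(t^2;q)_l}{(s^2;q)_i}\,\frac{(q;q)_i}{(q;q)_{i-l}(q;q)_l},$$ and $w_{u;s}(g,0;g,0)=\frac{1-suq^g}{1-su}$, $w_{u;s}(g,0;g-1,1)=\frac{(q^g-1)su}{1-su}$, $w_{u;s}(g,1;g+1,0)=\frac{1-s^2q^g}{1-su}$, $w_{u;s}(g,1;g,1)=\frac{s^2q^g-su}{1-su}$, all other values of $w_{u;s}$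 being $0$. **Functions.** Consider a grid with $L>l(\lambda),l(\mu)$ columns, numbered from left to right, and rows numbered from top to bottom, with left edge labels $a_i$, right edge labels $0$, bottom edge labels $m_j(\mu')$ and top edge labels $m_j(\lambda')$; its partition function is the sum over all labels of the internal edges of the product of the vertex weights (it does not depend on $L$). Let $ZW^{(a)}_{\lambda/\mu}(\kappa\mid\Xi,{\sf S})$ be the partition function with $n$ rows where the vertex in row $i$ and column $j$ has weight $W_{t,s}$, $t^2=s_{i+j}\xi_{i+j}/\kappa_i$, $s^2=s_{i+j}\xi_{i+j}s_j/\xi_j$, and let $Zw^{(a)}_{\lambda/\mu}(u\mid\Xi,{\sf S})$ be the one with $m$ rows and weights $w_{u_i\xi_j;s_j}$. The inhomogeneous spin $q$-Whittaker functions are $$\mathbb F_{\lambda/\mu}(\kappa\mid\Xi,{\sf S})=\frac{(-\tau^n_\Xi{\sf S})^\mu}{(-{\sf S})^\lambda}\frac{{\sf c}_{\tau^n_\Xi{\sf S}}(\mu)}{{\sf c}_{\sf S}(\lambda)}\sum_{a_1+\dots+a_n=\lambda_1-\mu_1}\ \prod_{i=1}^n\Big(\frac{\kappa_is_0}{\xi_0}\Big)^{a_i}\frac{(\kappa_i^{-1}s_i\xi_i;q)_{a_i}}{(q;q)_{a_i}}\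 ZW^{(a)}_{\lambda/\mu}(\kappa\mid\Xi,{\sf S}),$$ where $a_i\in\mathbb Z_{\ge0}$ (each term is a polynomial in $\kappa$, which also gives the value when some $\kappa_i=0$). The inhomogeneous stable spin Hall–Littlewood functions and their duals are $$\widetilde{\sf F}_{\lambda'/\mu'}(u\mid\Xi,{\sf S})=\frac{(-{\sf S})^\mu}{(-{\sf S})^\lambda}\frac{{\sf c}_{\sf S}(\mu)}{{\sf c}_{\sf S}(\lambda)}\sum_{a\in\{0,1\}^m}\ \prod_{i=1}^m(-u_i\xi_0s_0)^{a_i}\ Zw^{(a)}_{\lambda/\mu}(u\mid\Xi,{\sf S}),\qquad \widetilde{\sf F}^*_{\lambda'/\mu'}=\frac{{\sf c}_{\sf S}(\lambda)}{{\sf c}_{\sf S}(\mu)}\widetilde{\sf F}_{\lambda'/\mu'}.$$ **Theorem (skew dual Cauchy identity).** For any partitions $\mu,\nu$, $$\sum_\lambda \widetilde{\sf F}^*_{\lambda'/\nu'}(u_1,\dots,u_m\mid\Xi,{\sf S})\,\mathbb F_{\lambda/\mu}(\kappa_1,\dots,\kappa_n\mid\Xi,{\sf S})=\prod_{i=1}^n\prod_{j=1}^m\frac{1-u_j\kappa_i}{1-u_j\xi_is_i}\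 \sum_\lambda\mathbb F_{\nu/\lambda}(\kappa_1,\dots,\kappa_n\mid\Xi,{\sf S})\,\widetilde{\sf F}^*_{\mu'/\lambda'}(u_1,\dots,u_m\mid\tau^n_{\sf S}\Xi,\tau^n_\Xi{\sf S}),$$ where both sums, over all partitions $\lambda$, have only finitely many nonzero terms. -/

import Mathlib

namespace SpinWhittaker

variable {K : Type*} [Field K]

/-- The `q`-Pochhammer symbol `(x;q)_n = ∏_{r=0}^{n-1} (1 - x q^r)`. -/
def qPoch (q x : K) (n : ℕ) : K := ∏ r ∈ Finset.range n, (1 - x * q ^ r)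

/-- The polynomial `κ^n (x/κ;q)_n = ∏_{r=0}^{n-1} (κ - x q^r)`. -/
def qPochHom (q κ x : K) (n : ℕ) : K := ∏ r ∈ Finset.range n, (κ - x * q ^ r)

theorem qPochHom_eq (q κ x : K) (hκ : κ ≠ 0) (n : ℕ) :
    qPochHom q κ x n = κ ^ n * qPoch q (κ⁻¹ * x) n := by
  induction n with
  | zero => simp [qPochHom, qPoch]
  | succ n ih =>
    simp only [qPochHom, qPoch, Finset.prod_range_succ] at ih ⊢
    have h : κ - x * q ^ n = κ * (1 - κ⁻¹ * x * q ^ n) := by field_simp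
    rw [ih, h]
    ring

/-! ### Vertex weights

Arguments `i j k l` are the labels of the bottom (incoming), left (incoming), top (outgoing) and
right (outgoing) edges of a vertex. -/

/-- The stochastic higher spin six vertex weight `w_{u;s}(i,j;k,l)`. -/
def hsWeight (q u s : K) (i j k l : ℕ) : K :=
  if i + j = k + l then
    match j, l with
    | 0, 0 => (1 - s * u * q ^ i) / (1 - s * u)
    | 0, 1 => (q ^ i - 1) * (s * u) / (1 - s * u)
    | 1, 0 => (1 - s ^ 2 * q ^ i) / (1 - s * u)
    | 1, 1 => (s ^ 2 * q ^ i - s * u) / (1 - s * u)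
    | _, _ => 0
  else 0

/-- The `q`-Hahn weight `W_{t,s}(i,j;k,l)`. -/
def qHahnWeight (q t s : K) (i j k l : ℕ) : K :=
  if i + j = k + l ∧ l ≤ i then
    s ^ (2 * l) / t ^ (2 * l) *
      (qPoch q (s ^ 2 / t ^ 2) (i - l) * qPoch q (t ^ 2) l / qPoch q (s ^ 2) i) *
      (qPoch q q i / (qPoch q q (i - l) * qPoch q q l))
  else 0

/-- The `q`-Hahn weight with `t ^ 2 = p / κ` and `s ^ 2 = σ`, written as a polynomial in `κ`
(so that `κ = 0` is allowed); see `qHahnWeightPoly_eq`. -/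
def qHahnWeightPoly (q κ p σ : K) (i j k l : ℕ) : K :=
  if i + j = k + l ∧ l ≤ i then
    (σ / p) ^ l *
      (qPoch q (κ * σ / p) (i - l) * qPochHom q κ p l / qPoch q σ i) *
      (qPoch q q i / (qPoch q q (i - l) * qPoch q q l))
  else 0

theorem qHahnWeightPoly_eq (q κ p σ t s : K) (hκ : κ ≠ 0) (hp : p ≠ 0)
    (ht : t ^ 2 = p / κ) (hs : s ^ 2 = σ) (i j k l : ℕ) :
    qHahnWeightPoly q κ p σ i j k l = qHahnWeight q t s i j k l := by
  unfold qHahnWeightPoly qHahnWeight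
  split_ifs with h
  · rw [pow_mul, pow_mul, ht, hs, qPochHom_eq q κ p hκ,
      show σ / (p / κ) = κ * σ / p by field_simp, show κ⁻¹ * p = p / κ by field_simp,
      div_pow, div_pow]
    field_simp
  · rfl

/-! ### Partition functions on a rectangular grid -/

/-- The partition function of a grid with `n` rows (numbered from top to bottom) and `L` columns
(numbered from left to right), vertical edges directed upwards, horizontal edges directed to the
right. The vertex in row `r` and column `c` has weight `w r c`, the left incoming edges have labels
`a`, the bottom edges have labels `bot`, the top edges have labels `top`, and all right outgoing
edges have label `0`.

A configuration consists of labels `v` of the vertical edges (`v r c` sits right above row `r`, and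
`v n c` right below the last row) and labels `h` of the horizontal edges (`h r c` sits immediately
to the left of column `c`, and `h r L` to the right of the last column). For weights obeying the
conservation law `i + j = k + l` no label exceeds the total of the incoming labels in a
configuration of nonzero weight, so the labels are taken up to that total. -/
def gridZ {n L : ℕ} (w : Fin n → Fin L → ℕ → ℕ → ℕ → ℕ → K)
    (a : Fin n → ℕ) (bot top : Fin L → ℕ) : K :=
  let labels := Finset.range (∑ r, a r + ∑ c, bot c + 1)
  ∑ v ∈ Fintype.piFinset (fun _ : Fin (n + 1) => Fintype.piFinset (fun _ : Fin L => labels)),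
    ∑ h ∈ Fintype.piFinset (fun _ : Fin n => Fintype.piFinset (fun _ : Fin (L + 1) => labels)),
      if v 0 = top ∧ v (Fin.last n) = bot ∧ (∀ r, h r 0 = a r) ∧ (∀ r, h r (Fin.last L) = 0) then
        ∏ r : Fin n, ∏ c : Fin L,
          w r c (v r.succ c) (h r c.castSucc) (v r.castSucc c) (h r c.succ)
      else 0

/-! ### Partitions

Partitions are Young diagrams: the `i`-th part `λ_i` (`i ≥ 1`) is `lam.rowLen (i - 1)`, the length
`l(λ)` is `lam.colLen 0`, and the conjugate `λ'` is `lam.transpose`. -/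

/-- The labels `m_j(λ') = λ_j - λ_{j+1}` for `j = 1, …, L`. -/
def edgeLabels (lam : YoungDiagram) (L : ℕ) : Fin L → ℕ :=
  fun c => lam.rowLen c - lam.rowLen (c + 1)

/-- A number of columns larger than both `l(λ)` and `l(μ)`. -/
def numCols (lam mu : YoungDiagram) : ℕ := max (lam.colLen 0) (mu.colLen 0) + 1

/-- `c_S(λ) = ∏_{i ≥ 1} (s_i^2;q)_{λ_i - λ_{i+1}} / (q;q)_{λ_i - λ_{i+1}}`. -/
def cNorm (q : K) (S : ℕ → K) (lam : YoungDiagram) : K :=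
  ∏ i ∈ Finset.range (lam.colLen 0),
    qPoch q (S (i + 1) ^ 2) (lam.rowLen i - lam.rowLen (i + 1)) /
      qPoch q q (lam.rowLen i - lam.rowLen (i + 1))

/-- `(-S)^λ = ∏_{i ≥ 1} (-s_{i-1})^{λ_i}`. -/
def negPow (S : ℕ → K) (lam : YoungDiagram) : K :=
  ∏ i ∈ Finset.range (lam.colLen 0), (-S i) ^ lam.rowLen i

/-- The mixed shift `τ_B^k A`, with `i`-th entry `√(a_{i+k} b_{i+k} a_i / b_i)`. The square roots
are treated formally: `rA` and `rB` are chosen sequences of square roots of the entries of `A`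
and `B`. -/
def mixedShift (k : ℕ) (rA rB : ℕ → K) : ℕ → K :=
  fun i => rA (i + k) * rB (i + k) * rA i / rB i

theorem mixedShift_sq (k : ℕ) (rA rB A B : ℕ → K) (hA : ∀ i, rA i ^ 2 = A i)
    (hB : ∀ i, rB i ^ 2 = B i) (i : ℕ) :
    mixedShift k rA rB i ^ 2 = A (i + k) * B (i + k) * A i / B i := by
  simp only [mixedShift, ← hA, ← hB, div_pow, mul_pow]

/-! ### Inhomogeneous spin `q`-Whittaker functions -/

/-- The partition function `ZW_{λ/μ}^{(a_1,…,a_n)}(κ_1,…,κ_n | Ξ,S)`: the vertex in row `i` and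
column `j` (`i, j ≥ 1`) has the weight `W_{t,s}` with `t^2 = s_{i+j} ξ_{i+j} / κ_i` and
`s^2 = s_{i+j} ξ_{i+j} s_j / ξ_j`. -/
def ZW (q : K) (Ξ S : ℕ → K) {n : ℕ} (κ : Fin n → K) (a : Fin n → ℕ)
    (lam mu : YoungDiagram) : K :=
  gridZ
    (fun (r : Fin n) (c : Fin (numCols lam mu)) =>
      let i : ℕ := r + 1
      let j : ℕ := c + 1
      qHahnWeightPoly q (κ r) (S (i + j) * Ξ (i + j)) (S (i + j) * Ξ (i + j) * S j / Ξ j))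
    a (edgeLabels mu _) (edgeLabels lam _)

/-- The stochastic normalization `𝔽^s_{λ/μ}(κ_1,…,κ_n | Ξ,S)`: the sum over `a_1,…,a_n ≥ 0` with
`a_1 + ⋯ + a_n = λ_1 - μ_1` of
`∏_i (κ_i s_0/ξ_0)^{a_i} (κ_i⁻¹ s_i ξ_i;q)_{a_i} / (q;q)_{a_i} * ZW^{(a_1,…,a_n)}_{λ/μ}`. -/
def stochSpinQWhittaker (q : K) (Ξ S : ℕ → K) {n : ℕ} (κ : Fin n → K)
    (lam mu : YoungDiagram) : K :=
  ∑ a ∈ Fintype.piFinset (fun _ : Fin n => Finset.range (lam.rowLen 0 + 1)),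
    if mu.rowLen 0 + ∑ r, a r = lam.rowLen 0 then
      (∏ r : Fin n, (S 0 / Ξ 0) ^ a r *
        qPochHom q (κ r) (S (r + 1) * Ξ (r + 1)) (a r) / qPoch q q (a r)) *
      ZW q Ξ S κ a lam mu
    else 0

/-- The inhomogeneous spin `q`-Whittaker function `𝔽_{λ/μ}(κ_1,…,κ_n | Ξ,S)`; `rΞ` and `rS` are the
chosen square roots of `Ξ` and `S`, which enter through `τ_Ξ^n S`. -/
def spinQWhittaker (q : K) (Ξ S rΞ rS : ℕ → K) {n : ℕ} (κ : Fin n → K)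
    (lam mu : YoungDiagram) : K :=
  negPow (mixedShift n rS rΞ) mu / negPow S lam *
    (cNorm q (mixedShift n rS rΞ) mu / cNorm q S lam) *
    stochSpinQWhittaker q Ξ S κ lam mu

/-! ### Inhomogeneous stable spin Hall-Littlewood functions -/

/-- The partition function `Zw_{λ/μ}^{(a_1,…,a_n)}(u_1,…,u_n | Ξ,S)`: the vertex in row `i` and
column `j` (`i, j ≥ 1`) has the weight `w_{u_i ξ_j; s_j}`. -/
def Zw (q : K) (Ξ S : ℕ → K) {n : ℕ} (u : Fin n → K) (a : Fin n → ℕ)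
    (lam mu : YoungDiagram) : K :=
  gridZ
    (fun (r : Fin n) (c : Fin (numCols lam mu)) =>
      hsWeight q (u r * Ξ (c + 1)) (S (c + 1)))
    a (edgeLabels mu _) (edgeLabels lam _)

/-- The stochastic normalization `F̃^s_{λ/μ}(u_1,…,u_n | Ξ,S)`; the partition function is attached
to the conjugate partitions `λ'` and `μ'`. -/
def stochStableHL (q : K) (Ξ S : ℕ → K) {n : ℕ} (u : Fin n → K)
    (lam mu : YoungDiagram) : K :=
  ∑ a ∈ Fintype.piFinset (fun _ : Fin n => Finset.range 2),
    (∏ r : Fin n, (-(u r * Ξ 0 * S 0)) ^ a r) * Zw q Ξ S u a lam.transpose mu.transpose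

/-- The inhomogeneous stable spin Hall-Littlewood function `F̃_{λ/μ}(u_1,…,u_n | Ξ,S)`. -/
def stableHL (q : K) (Ξ S : ℕ → K) {n : ℕ} (u : Fin n → K) (lam mu : YoungDiagram) : K :=
  negPow S mu.transpose / negPow S lam.transpose *
    (cNorm q S mu.transpose / cNorm q S lam.transpose) *
    stochStableHL q Ξ S u lam mu

/-- The dual function `F̃*_{λ/μ}(u_1,…,u_n | Ξ,S) = c_S(λ') / c_S(μ') * F̃_{λ/μ}`. -/
def dualStableHL (q : K) (Ξ S : ℕ → K) {n : ℕ} (u : Fin n → K) (lam mu : YoungDiagram) : K :=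
  cNorm q S lam.transpose / cNorm q S mu.transpose * stableHL q Ξ S u lam mu

end SpinWhittaker

namespace SpinWhittaker

/-! ### Young diagrams as sequences of parts -/

/-! In a single row, the conservation law and the right label 0 force the horizontal labels to be
`λ_c - μ_c`. A row is therefore a kernel on pairs of partitions with no internal sum, and both
families of functions are compositions of such kernels, one per variable
(`sum_gridSum_eq_kernelIter`). A Cauchy identity moves one kernel past another, so it can be
composed in either slot (`IsCauchy.comp_right`, `IsCauchy.comp_left`), and one `κ` and one `u`
suffice.

The square roots disappear in the coordinates `p_i = s_i ξ_i`, `r_i = s_i / ξ_i`: the mixed shift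
sends `p_i` to `p_{i+k}` and fixes `r_i`. Passing one `κ` shifts `p` by one step. The prefactors in
`c_S` and `(-S)^λ` are diagonal conjugations; they telescope along a composition
(`kernelIter_gauge`) and cancel at the summed partition.

For one `κ` and one `u` (`isCauchy_one`) the Hall-Littlewood factor forces `ε_c = λ_c - ν_c` on the
left and `ε_c = μ_c - λ_c` on the right to lie in `{0,1}`. After normalization each q-Hahn weight
splits into a factor `hF` and a factor `hG`, so both sums become products of 2×2 transfer matrices
over the columns, with the same prefactor `∏ r_c^{ν_c - μ_c}`. With `d = ν_c - μ_c` and `P` the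
parameter of the column, the matrix `M_c = [[1 - uPq^d, -u(κ - Pq^d)], [1 - q^{d+1}, q^{d+1} - uκ]]`
satisfies (left transfer) `M_{c+1} = M_c` (right transfer): this is `Intertwined.step`, the local
exchange relation behind the theorem. At the left boundary the row vector of edge weights is an
eigenvector of `M_0` with eigenvalue `1 - uκ` (`Intertwined.left_sum`). At the right boundary both
partitions are empty and `M` sends `(1, 0)` to `(1 - uP, 1 - q)`. Comparing the denominators `1 - u
p_c` of the two sides leaves `(1 - uκ)/(1 - u p_1)`. -/

theorem rowLen_eq_zero_iff (lam : YoungDiagram) (i : ℕ) : lam.rowLen i = 0 ↔ lam.colLen 0 ≤ i := by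
  have h : 0 < lam.rowLen i ↔ i < lam.colLen 0 := by
    rw [← YoungDiagram.mem_iff_lt_rowLen, YoungDiagram.mem_iff_lt_colLen]
  omega

theorem le_iff_rowLen_le (mu lam : YoungDiagram) :
    mu ≤ lam ↔ ∀ i, mu.rowLen i ≤ lam.rowLen i := by
  constructor
  · intro h i
    by_contra! hc
    have h1 : (i, lam.rowLen i) ∈ lam := h (YoungDiagram.mem_iff_lt_rowLen.2 hc)
    exact absurd (YoungDiagram.mem_iff_lt_rowLen.1 h1) (lt_irrefl _)
  · rintro h ⟨i, j⟩ hij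
    exact YoungDiagram.mem_iff_lt_rowLen.2
      (lt_of_lt_of_le (YoungDiagram.mem_iff_lt_rowLen.1 hij) (h i))

theorem colLen_mono {mu lam : YoungDiagram} (h : mu ≤ lam) : mu.colLen 0 ≤ lam.colLen 0 := by
  rw [← rowLen_eq_zero_iff]
  have h1 := (le_iff_rowLen_le mu lam).1 h (lam.colLen 0)
  have h2 := (rowLen_eq_zero_iff lam (lam.colLen 0)).2 le_rfl
  omega

theorem eq_of_rowLen_eq {mu lam : YoungDiagram} (h : ∀ i, mu.rowLen i = lam.rowLen i) :
    mu = lam :=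
  le_antisymm ((le_iff_rowLen_le _ _).2 fun i => (h i).le)
    ((le_iff_rowLen_le _ _).2 fun i => (h i).ge)

theorem exists_rowLen_eq (f : ℕ → ℕ) (hf : Antitone f) (L : ℕ) (hL : f L = 0) :
    ∃ lam : YoungDiagram, (∀ i, lam.rowLen i = f i) ∧ lam.colLen 0 ≤ L := by
  let lam : YoungDiagram :=
    ⟨(Finset.range L ×ˢ Finset.range (f 0)).filter (fun c => c.2 < f c.1), by
      rintro ⟨i, j⟩ ⟨i', j'⟩ hle hmem
      have h1 : i' ≤ i := hle.1
      have h2 : j' ≤ j := hle.2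
      simp only [Finset.coe_filter, Finset.mem_product, Finset.mem_range,
        Set.mem_ofPred_eq] at hmem ⊢
      have := hf h1
      omega⟩
  have hmem : ∀ i j, (i, j) ∈ lam ↔ j < f i := by
    intro i j
    change (i, j) ∈ (Finset.range L ×ˢ Finset.range (f 0)).filter (fun c => c.2 < f c.1) ↔ _
    simp only [Finset.mem_filter, Finset.mem_product, Finset.mem_range]
    refine ⟨fun h => h.2, fun h => ⟨⟨?_, lt_of_lt_of_le h (hf (Nat.zero_le i))⟩, h⟩⟩
    by_contra! hc
    have := hf hc
    omega
  have hrow : ∀ i, lam.rowLen i = f i := by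
    intro i
    have h : ∀ j, j < lam.rowLen i ↔ j < f i := fun j => by
      rw [← YoungDiagram.mem_iff_lt_rowLen, hmem]
    have h1 := h (lam.rowLen i)
    have h2 := h (f i)
    omega
  exact ⟨lam, hrow, by rw [← rowLen_eq_zero_iff, hrow, hL]⟩

theorem finite_le (lam : YoungDiagram) : {mu : YoungDiagram | mu ≤ lam}.Finite := by
  refine Set.Finite.of_finite_image (f := YoungDiagram.cells) ?_ ?_
  · refine (Finset.finite_toSet lam.cells.powerset).subset ?_
    rintro _ ⟨mu, hmu, rfl⟩
    exact Finset.mem_coe.2 (Finset.mem_powerset.2 (YoungDiagram.cells_subset_iff.2 hmu))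
  · intro a _ b _ hab
    exact YoungDiagram.ext hab

/-- Boxes are the common finite index sets in which all sums over partitions are rearranged. -/
theorem exists_box (a b : ℕ) : ∃ D : Finset YoungDiagram,
    ∀ lam : YoungDiagram, lam ∈ D ↔ lam.colLen 0 ≤ a ∧ lam.rowLen 0 ≤ b := by
  obtain ⟨box, hbox, -⟩ := exists_rowLen_eq (fun i => if i < a then b else 0)
    (by intro i j hij; dsimp only; split_ifs <;> omega) a (by simp)
  refine ⟨(finite_le box).toFinset, fun lam => ?_⟩
  simp only [Set.Finite.mem_toFinset, Set.mem_ofPred_eq, le_iff_rowLen_le, hbox]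
  constructor
  · intro h
    have h0 := h 0
    have ha := h a
    simp only [lt_irrefl, if_false] at ha
    refine ⟨(rowLen_eq_zero_iff _ _).1 (by omega), ?_⟩
    split_ifs at h0 <;> omega
  · rintro ⟨h1, h2⟩ i
    split_ifs with hi
    · exact (lam.rowLen_anti 0 i (Nat.zero_le i)).trans h2
    · exact ((rowLen_eq_zero_iff _ _).2 (by omega)).le

/-! ### Sums over a type of indices with finite support -/

/-- Only the supports need to correspond, so `e` may be arbitrary on indices with vanishing terms.
This suits label sequences that do not come from a partition. -/
theorem finsum_eq_sum_of_bij {α β M : Type*} [AddCommMonoid M] (F : α → M) (s : Finset β)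
    (G : β → M) (e : α → β) (he : ∀ x, F x ≠ 0 → e x ∈ s ∧ G (e x) = F x)
    (hinj : ∀ x y, F x ≠ 0 → F y ≠ 0 → e x = e y → x = y)
    (hsurj : ∀ y ∈ s, G y ≠ 0 → ∃ x, F x ≠ 0 ∧ e x = y) :
    ∑ᶠ x, F x = ∑ y ∈ s, G y := by
  classical
  rw [← finsum_mem_support, finsum_mem_eq_of_bijOn (g := G)
    (t := ((s.filter fun y => G y ≠ 0 : Finset β) : Set β)) e, finsum_mem_coe_finset,
    Finset.sum_filter_ne_zero]
  · refine ⟨fun x hx => ?_, fun x hx y hy h => hinj x y hx hy h, fun y hy => ?_⟩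
    · have h := he x hx
      simp only [Finset.coe_filter, Set.mem_ofPred_eq]
      exact ⟨h.1, h.2 ▸ hx⟩
    · simp only [Finset.coe_filter, Set.mem_ofPred_eq] at hy
      exact hsurj y hy.1 hy.2
  · exact fun x hx => (he x hx).2.symm

variable {K : Type*} [Field K]

/-! ### Kernels on Young diagrams -/

/-- A kernel that vanishes unless its second argument is contained in the first one. -/
def IsLower (X : YoungDiagram → YoungDiagram → K) : Prop :=
  ∀ lam mu, X lam mu ≠ 0 → mu ≤ lam

/-- The first row of the first argument exceeds that of the second one by a bounded amount. -/
def RowBounded (X : YoungDiagram → YoungDiagram → K) : Prop :=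
  ∃ k : ℕ, ∀ lam mu, X lam mu ≠ 0 → lam.rowLen 0 ≤ mu.rowLen 0 + k

/-- The first column of the first argument exceeds that of the second one by a bounded amount. -/
def ColBounded (X : YoungDiagram → YoungDiagram → K) : Prop :=
  ∃ k : ℕ, ∀ lam mu, X lam mu ≠ 0 → lam.colLen 0 ≤ mu.colLen 0 + k

open Classical in
/-- The identity kernel. -/
noncomputable def kernelOne (lam mu : YoungDiagram) : K := if lam = mu then 1 else 0

/-- The composition of two kernels. -/
noncomputable def kernelComp (X Y : YoungDiagram → YoungDiagram → K) (lam mu : YoungDiagram) : K :=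
  ∑ᶠ rho, X lam rho * Y rho mu

/-- The composition of the kernels `X 0, …, X (n - 1)`. -/
noncomputable def kernelIter : ℕ → (ℕ → YoungDiagram → YoungDiagram → K) → YoungDiagram → YoungDiagram → K
  | 0, _ => kernelOne
  | n + 1, X => kernelComp (X 0) (kernelIter n fun r => X (r + 1))

theorem isLower_kernelOne : IsLower (kernelOne (K := K)) := by
  intro lam mu h
  unfold kernelOne at h
  split_ifs at h with h1
  · exact h1.ge
  · exact absurd rfl h

theorem kernelComp_ne_zero {X Y : YoungDiagram → YoungDiagram → K} {lam mu : YoungDiagram}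
    (h : kernelComp X Y lam mu ≠ 0) : ∃ rho, X lam rho ≠ 0 ∧ Y rho mu ≠ 0 := by
  by_contra! hc
  refine h (finsum_eq_zero_of_forall_eq_zero fun rho => ?_)
  by_cases h1 : X lam rho = 0
  · rw [h1, zero_mul]
  · rw [hc rho h1, mul_zero]

theorem IsLower.comp {X Y : YoungDiagram → YoungDiagram → K} (hX : IsLower X) (hY : IsLower Y) :
    IsLower (kernelComp X Y) := by
  intro lam mu h
  obtain ⟨rho, h1, h2⟩ := kernelComp_ne_zero h
  exact (hY _ _ h2).trans (hX _ _ h1)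

theorem RowBounded.comp {X Y : YoungDiagram → YoungDiagram → K} (hX : RowBounded X)
    (hY : RowBounded Y) : RowBounded (kernelComp X Y) := by
  obtain ⟨a, ha⟩ := hX
  obtain ⟨b, hb⟩ := hY
  refine ⟨a + b, fun lam mu h => ?_⟩
  obtain ⟨rho, h1, h2⟩ := kernelComp_ne_zero h
  have := ha _ _ h1
  have := hb _ _ h2
  omega

theorem ColBounded.comp {X Y : YoungDiagram → YoungDiagram → K} (hX : ColBounded X)
    (hY : ColBounded Y) : ColBounded (kernelComp X Y) := by
  obtain ⟨a, ha⟩ := hX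
  obtain ⟨b, hb⟩ := hY
  refine ⟨a + b, fun lam mu h => ?_⟩
  obtain ⟨rho, h1, h2⟩ := kernelComp_ne_zero h
  have := ha _ _ h1
  have := hb _ _ h2
  omega

theorem IsLower.iter (n : ℕ) (X : ℕ → YoungDiagram → YoungDiagram → K)
    (hX : ∀ r, IsLower (X r)) : IsLower (kernelIter n X) := by
  induction n generalizing X with
  | zero => exact isLower_kernelOne
  | succ n ih => exact (hX 0).comp (ih _ fun r => hX (r + 1))

theorem kernelOne_ne_zero {lam mu : YoungDiagram} (h : kernelOne (K := K) lam mu ≠ 0) :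
    lam = mu := by
  by_contra hc
  exact h (if_neg hc)

theorem RowBounded.iter (n : ℕ) (X : ℕ → YoungDiagram → YoungDiagram → K)
    (hX : ∀ r, RowBounded (X r)) : RowBounded (kernelIter n X) := by
  induction n generalizing X with
  | zero => exact ⟨0, fun lam mu h => (congrArg (YoungDiagram.rowLen · 0) (kernelOne_ne_zero h)).le⟩
  | succ n ih => exact (hX 0).comp (ih _ fun r => hX (r + 1))

theorem ColBounded.iter (n : ℕ) (X : ℕ → YoungDiagram → YoungDiagram → K)
    (hX : ∀ r, ColBounded (X r)) : ColBounded (kernelIter n X) := by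
  induction n generalizing X with
  | zero => exact ⟨0, fun lam mu h => (congrArg (YoungDiagram.colLen · 0) (kernelOne_ne_zero h)).le⟩
  | succ n ih => exact (hX 0).comp (ih _ fun r => hX (r + 1))

theorem kernelComp_eq_sum {X : YoungDiagram → YoungDiagram → K} (hX : IsLower X)
    (Y : YoungDiagram → YoungDiagram → K) (lam mu : YoungDiagram) (D : Finset YoungDiagram)
    (hD : ∀ rho ≤ lam, rho ∈ D) : kernelComp X Y lam mu = ∑ rho ∈ D, X lam rho * Y rho mu :=
  finsum_eq_sum_of_support_subset _ fun rho h => hD rho (hX _ _ (left_ne_zero_of_mul h))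

/-- Conjugating the factors by diagonal matrices conjugates the composition. -/
theorem kernelIter_gauge (n : ℕ) (X : ℕ → YoungDiagram → YoungDiagram → K)
    (g : ℕ → YoungDiagram → K) (hg : ∀ r ≤ n, ∀ lam, g r lam ≠ 0) (lam mu : YoungDiagram) :
    kernelIter n (fun r lam mu => g (r + 1) mu / g r lam * X r lam mu) lam mu =
      g n mu / g 0 lam * kernelIter n X lam mu := by
  induction n generalizing X g lam with
  | zero =>
    simp only [kernelIter, kernelOne]
    split_ifs with h
    · rw [h, div_self (hg 0 le_rfl mu), one_mul]
    · rw [mul_zero]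
  | succ n ih =>
    simp only [kernelIter, kernelComp]
    rw [mul_finsum]
    refine finsum_congr fun rho => ?_
    rw [ih (fun r => X (r + 1)) (fun r => g (r + 1)) (fun r hr => hg (r + 1) (by omega))]
    have h1 := hg (0 + 1) (by omega) rho
    field_simp

/-! ### Cauchy identities for kernels -/

/-- The identity `∑_λ A(λ,ν) B(λ,μ) = c ∑_λ B(ν,λ) A'(μ,λ)`. -/
def IsCauchy (c : K) (A B A' : YoungDiagram → YoungDiagram → K) : Prop :=
  ∀ nu mu, ∑ᶠ lam, A lam nu * B lam mu = c * ∑ᶠ lam, B nu lam * A' mu lam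

theorem finite_support_left {A B : YoungDiagram → YoungDiagram → K} (hA : RowBounded A)
    (hB : ColBounded B) (nu mu : YoungDiagram) : {lam | A lam nu * B lam mu ≠ 0}.Finite := by
  obtain ⟨a, ha⟩ := hA
  obtain ⟨b, hb⟩ := hB
  obtain ⟨D, hD⟩ := exists_box (mu.colLen 0 + b) (nu.rowLen 0 + a)
  refine (Finset.finite_toSet D).subset fun lam h => ?_
  exact (hD lam).2 ⟨hb _ _ (right_ne_zero_of_mul h), ha _ _ (left_ne_zero_of_mul h)⟩

theorem finite_support_right {A B : YoungDiagram → YoungDiagram → K} (hB : IsLower B)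
    (nu mu : YoungDiagram) : {lam | B nu lam * A mu lam ≠ 0}.Finite :=
  (finite_le nu).subset fun _ h => hB _ _ (left_ne_zero_of_mul h)

theorem isCauchy_kernelOne_right (A : YoungDiagram → YoungDiagram → K) :
    IsCauchy 1 A kernelOne A := by
  intro nu mu
  rw [finsum_eq_single _ mu, finsum_eq_single _ nu]
  · simp [kernelOne]
  · intro lam h
    simp [kernelOne, h.symm]
  · intro lam h
    simp [kernelOne, h]

theorem isCauchy_kernelOne_left (B : YoungDiagram → YoungDiagram → K) :
    IsCauchy 1 kernelOne B kernelOne := by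
  intro nu mu
  rw [finsum_eq_single _ nu, finsum_eq_single _ mu]
  · simp [kernelOne]
  · intro lam h
    simp [kernelOne, h.symm]
  · intro lam h
    simp [kernelOne, h]

/-- `A` passes `B` and becomes `A'`, which then passes `B'` and becomes `A''`. The content is the
interchange of sums, legitimate because everything happens inside one finite box closed under
containment. -/
theorem IsCauchy.comp_right {c c' : K} {A B A' B' A'' : YoungDiagram → YoungDiagram → K}
    (h : IsCauchy c A B A') (h' : IsCauchy c' A' B' A'') (hA : RowBounded A)
    (hA' : RowBounded A') (hB : IsLower B) (hB' : IsLower B') (hBc : ColBounded B)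
    (hBc' : ColBounded B') :
    IsCauchy (c * c') A (kernelComp B B') A'' := by
  intro nu mu
  obtain ⟨a, ha⟩ := hA
  obtain ⟨a', ha'⟩ := hA'
  obtain ⟨b, hb⟩ := hBc
  obtain ⟨b', hb'⟩ := hBc'
  -- The sides are generous: the box must hold both outer sums and every intermediate sum.
  obtain ⟨D, hD⟩ := exists_box (mu.colLen 0 + b' + b + nu.colLen 0)
    (nu.rowLen 0 + a + a' + mu.rowLen 0)
  have hlow : ∀ lam ∈ D, ∀ rho ≤ lam, rho ∈ D := by
    intro lam hl rho hr
    have h1 := (hD lam).1 hl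
    have h2 := (le_iff_rowLen_le _ _).1 hr 0
    have h3 := colLen_mono hr
    exact (hD rho).2 ⟨by omega, by omega⟩
  have hnu : nu ∈ D := (hD nu).2 ⟨by omega, by omega⟩
  have hmu : mu ∈ D := (hD mu).2 ⟨by omega, by omega⟩
  rw [finsum_eq_sum_of_support_subset (s := D), finsum_eq_sum_of_support_subset (s := D)]
  · calc ∑ lam ∈ D, A lam nu * kernelComp B B' lam mu
        = ∑ rho ∈ D, (∑ lam ∈ D, A lam nu * B lam rho) * B' rho mu := by
          simp only [Finset.sum_mul]
          rw [Finset.sum_comm]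
          refine Finset.sum_congr rfl fun lam hl => ?_
          rw [kernelComp_eq_sum hB B' lam mu D (hlow lam hl), Finset.mul_sum]
          exact Finset.sum_congr rfl fun _ _ => (mul_assoc _ _ _).symm
      _ = ∑ rho ∈ D, (c * ∑ sig ∈ D, B nu sig * A' rho sig) * B' rho mu := by
          refine Finset.sum_congr rfl fun rho hr => ?_
          -- The box holds the whole support of the inner sum only when `rho` is reachable from
          -- `mu`; otherwise the term is zero anyway.
          by_cases h0 : B' rho mu = 0
          · rw [h0, mul_zero, mul_zero]
          · have h1 := h nu rho
            rw [finsum_eq_sum_of_support_subset (s := D),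
              finsum_eq_sum_of_support_subset (s := D)] at h1
            · rw [h1]
            · exact fun lam hl => hlow nu hnu _ (hB _ _ (left_ne_zero_of_mul hl))
            · intro lam hl
              have h2 := hb _ _ (right_ne_zero_of_mul hl)
              have h3 := ha _ _ (left_ne_zero_of_mul hl)
              have h4 := hb' _ _ h0
              exact (hD lam).2 ⟨by omega, by omega⟩
      _ = c * ∑ sig ∈ D, B nu sig * ∑ rho ∈ D, A' rho sig * B' rho mu := by
          simp only [Finset.sum_mul, Finset.mul_sum]
          rw [Finset.sum_comm]
          exact Finset.sum_congr rfl fun _ _ => Finset.sum_congr rfl fun _ _ => by ring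
      _ = c * ∑ sig ∈ D, B nu sig * (c' * ∑ lam ∈ D, B' sig lam * A'' mu lam) := by
          congr 1
          refine Finset.sum_congr rfl fun sig hs => ?_
          by_cases h0 : B nu sig = 0
          · rw [h0, zero_mul, zero_mul]
          have h1 := h' sig mu
          rw [finsum_eq_sum_of_support_subset (s := D),
            finsum_eq_sum_of_support_subset (s := D)] at h1
          · rw [h1]
          · exact fun lam hl => hlow sig hs _ (hB' _ _ (left_ne_zero_of_mul hl))
          · intro rho hr
            have h2 := hb' _ _ (right_ne_zero_of_mul hr)
            have h3 := ha' _ _ (left_ne_zero_of_mul hr)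
            have h4 := (le_iff_rowLen_le _ _).1 (hB _ _ h0) 0
            exact (hD rho).2 ⟨by omega, by omega⟩
      _ = c * c' * ∑ lam ∈ D, kernelComp B B' nu lam * A'' mu lam := by
          simp only [Finset.mul_sum]
          rw [Finset.sum_comm]
          refine Finset.sum_congr rfl fun lam hl => ?_
          rw [kernelComp_eq_sum hB B' nu lam D (hlow nu hnu), Finset.sum_mul, Finset.mul_sum]
          exact Finset.sum_congr rfl fun _ _ => by ring
  · exact fun lam hl => hlow nu hnu _ ((hB.comp hB') _ _ (left_ne_zero_of_mul hl))
  · intro lam hl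
    have h3 := ha _ _ (left_ne_zero_of_mul hl)
    obtain ⟨rho, h1, h2⟩ := kernelComp_ne_zero (right_ne_zero_of_mul hl)
    have h4 := hb _ _ h1
    have h5 := hb' _ _ h2
    exact (hD lam).2 ⟨by omega, by omega⟩

/-- Here `B` stays the same: it is passed first by `A₁`, next to `B` in the sum over `lam`, and then
by `A₂`. Containment for `A₁'` bounds the length of the intermediate partition by that of `mu`. -/
theorem IsCauchy.comp_left {c c' : K} {A₁ A₂ B A₁' A₂' : YoungDiagram → YoungDiagram → K}
    (h₁ : IsCauchy c A₁ B A₁') (h₂ : IsCauchy c' A₂ B A₂') (hA₁ : RowBounded A₁)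
    (hA₂ : RowBounded A₂) (hAl₁ : IsLower A₁) (hAl₁' : IsLower A₁') (hB : IsLower B)
    (hBc : ColBounded B) :
    IsCauchy (c * c') (kernelComp A₁ A₂) B (kernelComp A₁' A₂') := by
  intro nu mu
  obtain ⟨a, ha⟩ := hA₁
  obtain ⟨a', ha'⟩ := hA₂
  obtain ⟨b, hb⟩ := hBc
  obtain ⟨D, hD⟩ := exists_box (mu.colLen 0 + b + nu.colLen 0)
    (nu.rowLen 0 + a + a' + mu.rowLen 0)
  have hlow : ∀ lam ∈ D, ∀ rho ≤ lam, rho ∈ D := by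
    intro lam hl rho hr
    have h1 := (hD lam).1 hl
    have h2 := (le_iff_rowLen_le _ _).1 hr 0
    have h3 := colLen_mono hr
    exact (hD rho).2 ⟨by omega, by omega⟩
  have hnu : nu ∈ D := (hD nu).2 ⟨by omega, by omega⟩
  have hmu : mu ∈ D := (hD mu).2 ⟨by omega, by omega⟩
  rw [finsum_eq_sum_of_support_subset (s := D), finsum_eq_sum_of_support_subset (s := D)]
  · calc ∑ lam ∈ D, kernelComp A₁ A₂ lam nu * B lam mu
        = ∑ rho ∈ D, (∑ lam ∈ D, A₁ lam rho * B lam mu) * A₂ rho nu := by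
          simp only [Finset.sum_mul]
          rw [Finset.sum_comm]
          refine Finset.sum_congr rfl fun lam hl => ?_
          rw [kernelComp_eq_sum hAl₁ A₂ lam nu D (hlow lam hl), Finset.sum_mul]
          exact Finset.sum_congr rfl fun _ _ => by ring
      _ = ∑ rho ∈ D, (c * ∑ sig ∈ D, B rho sig * A₁' mu sig) * A₂ rho nu := by
          refine Finset.sum_congr rfl fun rho hr => ?_
          by_cases h0 : A₂ rho nu = 0
          · rw [h0, mul_zero, mul_zero]
          · have h1 := h₁ rho mu
            rw [finsum_eq_sum_of_support_subset (s := D),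
              finsum_eq_sum_of_support_subset (s := D)] at h1
            · rw [h1]
            · exact fun lam hl => hlow rho hr _ (hB _ _ (left_ne_zero_of_mul hl))
            · intro lam hl
              have h2 := hb _ _ (right_ne_zero_of_mul hl)
              have h3 := ha _ _ (left_ne_zero_of_mul hl)
              have h4 := ha' _ _ h0
              exact (hD lam).2 ⟨by omega, by omega⟩
      _ = c * ∑ sig ∈ D, A₁' mu sig * ∑ rho ∈ D, A₂ rho nu * B rho sig := by
          simp only [Finset.sum_mul, Finset.mul_sum]
          rw [Finset.sum_comm]
          exact Finset.sum_congr rfl fun _ _ => Finset.sum_congr rfl fun _ _ => by ring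
      _ = c * ∑ sig ∈ D, A₁' mu sig * (c' * ∑ lam ∈ D, B nu lam * A₂' sig lam) := by
          congr 1
          refine Finset.sum_congr rfl fun sig hs => ?_
          by_cases h0 : A₁' mu sig = 0
          · rw [h0, zero_mul, zero_mul]
          have h1 := h₂ nu sig
          rw [finsum_eq_sum_of_support_subset (s := D),
            finsum_eq_sum_of_support_subset (s := D)] at h1
          · rw [h1]
          · exact fun lam hl => hlow nu hnu _ (hB _ _ (left_ne_zero_of_mul hl))
          · intro rho hr
            have h2 := hb _ _ (right_ne_zero_of_mul hr)
            have h3 := ha' _ _ (left_ne_zero_of_mul hr)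
            have h4 := colLen_mono (hAl₁' _ _ h0)
            exact (hD rho).2 ⟨by omega, by omega⟩
      _ = c * c' * ∑ lam ∈ D, B nu lam * kernelComp A₁' A₂' mu lam := by
          simp only [Finset.mul_sum]
          rw [Finset.sum_comm]
          refine Finset.sum_congr rfl fun lam hl => ?_
          rw [kernelComp_eq_sum hAl₁' A₂' mu lam D (hlow mu hmu), Finset.mul_sum, Finset.mul_sum]
          exact Finset.sum_congr rfl fun _ _ => by ring
  · exact fun lam hl => hlow nu hnu _ (hB _ _ (left_ne_zero_of_mul hl))
  · intro lam hl
    have h3 := hb _ _ (right_ne_zero_of_mul hl)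
    obtain ⟨rho, h1, h2⟩ := kernelComp_ne_zero (left_ne_zero_of_mul hl)
    have h4 := ha _ _ h1
    have h5 := ha' _ _ h2
    exact (hD lam).2 ⟨by omega, by omega⟩

/-- Iterating a Cauchy identity over `B 0, …, B (n - 1)` with `A r` turning into `A (r + 1)`. -/
theorem IsCauchy.iter_right (n : ℕ) (c : ℕ → K)
    (A B : ℕ → YoungDiagram → YoungDiagram → K) (h : ∀ r < n, IsCauchy (c r) (A r) (B r) (A (r + 1)))
    (hA : ∀ r, RowBounded (A r)) (hB : ∀ r, IsLower (B r)) (hBc : ∀ r, ColBounded (B r)) :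
    IsCauchy (∏ r ∈ Finset.range n, c r) (A 0) (kernelIter n B) (A n) := by
  induction n generalizing c A B with
  | zero => exact isCauchy_kernelOne_right (A 0)
  | succ n ih =>
    rw [Finset.prod_range_succ', mul_comm]
    exact (h 0 n.succ_pos).comp_right
      (ih (fun r => c (r + 1)) (fun r => A (r + 1)) (fun r => B (r + 1))
        (fun r hr => h (r + 1) (by omega)) (fun r => hA (r + 1)) (fun r => hB (r + 1))
        fun r => hBc (r + 1))
      (hA 0) (hA 1) (hB 0) (IsLower.iter n _ fun r => hB (r + 1)) (hBc 0)
      (ColBounded.iter n _ fun r => hBc (r + 1))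

theorem IsCauchy.iter_left (m : ℕ) (c : ℕ → K) (B : YoungDiagram → YoungDiagram → K)
    (A A' : ℕ → YoungDiagram → YoungDiagram → K) (h : ∀ r < m, IsCauchy (c r) (A r) B (A' r))
    (hA : ∀ r, RowBounded (A r)) (hAl : ∀ r, IsLower (A r)) (hAl' : ∀ r, IsLower (A' r))
    (hB : IsLower B) (hBc : ColBounded B) :
    IsCauchy (∏ r ∈ Finset.range m, c r) (kernelIter m A) B (kernelIter m A') := by
  induction m generalizing c A A' with
  | zero => exact isCauchy_kernelOne_left B
  | succ n ih =>
    rw [Finset.prod_range_succ', mul_comm]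
    exact (h 0 n.succ_pos).comp_left
      (ih (fun r => c (r + 1)) (fun r => A (r + 1)) (fun r => A' (r + 1))
        (fun r hr => h (r + 1) (by omega)) (fun r => hA (r + 1)) (fun r => hAl (r + 1))
        fun r => hAl' (r + 1))
      (hA 0) (RowBounded.iter n _ fun r => hA (r + 1)) (hAl 0) (hAl' 0) hB hBc

/-! ### Row by row evaluation of partition functions -/

theorem sum_piFinset_cons {α M : Type*} [AddCommMonoid M] (n : ℕ) (s : Finset α)
    (F : (Fin (n + 1) → α) → M) :
    ∑ v ∈ Fintype.piFinset (fun _ : Fin (n + 1) => s), F v =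
      ∑ x ∈ s, ∑ v ∈ Fintype.piFinset (fun _ : Fin n => s), F (Fin.cons x v) := by
  rw [← Finset.sum_product']
  refine Finset.sum_bij' (fun v _ => (v 0, Fin.tail v)) (fun y _ => Fin.cons y.1 y.2)
    ?_ ?_ ?_ ?_ ?_
  · intro v hv
    rw [Fintype.mem_piFinset] at hv
    simp only [Finset.mem_product, Fintype.mem_piFinset]
    exact ⟨hv 0, fun i => hv i.succ⟩
  · rintro ⟨x, v⟩ hy
    simp only [Finset.mem_product, Fintype.mem_piFinset] at hy
    rw [Fintype.mem_piFinset]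
    intro i
    refine Fin.cases ?_ (fun j => ?_) i
    · exact hy.1
    · exact hy.2 j
  · intro v _
    exact Fin.cons_self_tail v
  · rintro ⟨x, v⟩ _
    simp
  · intro v _
    simp only [Fin.cons_self_tail]

/-- The partition function of `gridZ` with all labels smaller than `N`. -/
def gridSum (N : ℕ) {n L : ℕ} (w : Fin n → Fin L → ℕ → ℕ → ℕ → ℕ → K)
    (a : Fin n → ℕ) (bot top : Fin L → ℕ) : K :=
  ∑ v ∈ Fintype.piFinset (fun _ : Fin (n + 1) =>
      Fintype.piFinset (fun _ : Fin L => Finset.range N)),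
    ∑ h ∈ Fintype.piFinset (fun _ : Fin n =>
        Fintype.piFinset (fun _ : Fin (L + 1) => Finset.range N)),
      if v 0 = top ∧ v (Fin.last n) = bot ∧ (∀ r, h r 0 = a r) ∧ (∀ r, h r (Fin.last L) = 0) then
        ∏ r : Fin n, ∏ c : Fin L,
          w r c (v r.succ c) (h r c.castSucc) (v r.castSucc c) (h r c.succ)
      else 0

/-- The partition function of a single row. -/
def rowSum (N : ℕ) {L : ℕ} (w : Fin L → ℕ → ℕ → ℕ → ℕ → K) (a : ℕ) (bot top : Fin L → ℕ) : K :=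
  ∑ h ∈ Fintype.piFinset (fun _ : Fin (L + 1) => Finset.range N),
    if h 0 = a ∧ h (Fin.last L) = 0 then
      ∏ c : Fin L, w c (bot c) (h c.castSucc) (top c) (h c.succ)
    else 0

theorem gridZ_eq_gridSum {n L : ℕ} (w : Fin n → Fin L → ℕ → ℕ → ℕ → ℕ → K)
    (a : Fin n → ℕ) (bot top : Fin L → ℕ) :
    gridZ w a bot top = gridSum (∑ r, a r + ∑ c, bot c + 1) w a bot top := rfl

theorem sum_piFinset_zero {α M : Type*} [AddCommMonoid M] (s : Finset α) (F : (Fin 0 → α) → M) :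
    ∑ v ∈ Fintype.piFinset (fun _ : Fin 0 => s), F v = F Fin.elim0 := by
  rw [Finset.sum_eq_single_of_mem Fin.elim0 (Fintype.mem_piFinset.2 fun i => i.elim0)]
  exact fun v _ h => absurd (funext fun i => i.elim0) h

open Classical in
theorem gridSum_zero (N : ℕ) {L : ℕ} (w : Fin 0 → Fin L → ℕ → ℕ → ℕ → ℕ → K)
    (a : Fin 0 → ℕ) (bot top : Fin L → ℕ)
    (htop : top ∈ Fintype.piFinset (fun _ : Fin L => Finset.range N)) :
    gridSum N w a bot top = if top = bot then 1 else 0 := by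
  rw [gridSum, sum_piFinset_cons, Finset.sum_eq_single_of_mem top htop]
  · rw [sum_piFinset_zero, sum_piFinset_zero, Finset.prod_of_isEmpty]
    refine if_congr ⟨fun h => h.2.1, fun h => ⟨rfl, h, fun r => r.elim0, fun r => r.elim0⟩⟩ rfl rfl
  · intro x _ hne
    rw [sum_piFinset_zero, sum_piFinset_zero, if_neg]
    rintro ⟨h, -⟩
    exact hne h

/-- Splitting off the top row turns the grid into a matrix product over the labels `mid` between the
first row and the rest. -/
theorem gridSum_succ (N : ℕ) {n L : ℕ} (w : Fin (n + 1) → Fin L → ℕ → ℕ → ℕ → ℕ → K)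
    (a : Fin (n + 1) → ℕ) (bot top : Fin L → ℕ) (htop : ∀ c, top c < N) :
    gridSum N w a bot top =
      ∑ mid ∈ Fintype.piFinset (fun _ : Fin L => Finset.range N),
        rowSum N (w 0) (a 0) mid top *
          gridSum N (fun r => w r.succ) (fun r => a r.succ) bot mid := by
  have htop' : top ∈ Fintype.piFinset (fun _ : Fin L => Finset.range N) := by
    simpa [Fintype.mem_piFinset] using htop
  unfold gridSum
  rw [sum_piFinset_cons, Finset.sum_eq_single_of_mem top htop']
  · simp only [Finset.mul_sum]
    refine Eq.trans ?_ Finset.sum_comm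
    refine Finset.sum_congr rfl fun v hv => ?_
    have hmem : v 0 ∈ Fintype.piFinset (fun _ : Fin L => Finset.range N) :=
      Fintype.mem_piFinset.1 hv 0
    rw [Finset.sum_eq_single_of_mem (v 0) hmem]
    · rw [sum_piFinset_cons, rowSum, Finset.sum_comm]
      refine Finset.sum_congr rfl fun h _ => ?_
      rw [Finset.sum_mul]
      refine Finset.sum_congr rfl fun h0 _ => ?_
      simp only [Fin.forall_fin_succ, Fin.cons_zero, Fin.cons_succ, Fin.prod_univ_succ,
        Fin.castSucc_zero, ← Fin.succ_last, ← Fin.succ_castSucc, true_and]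
      split_ifs <;> first | rfl | (exfalso; tauto) | simp
    · intro mid _ hne
      refine Finset.sum_eq_zero fun h _ => ?_
      rw [if_neg fun hc => hne hc.1.symm, mul_zero]
  · intro x _ hne
    refine Finset.sum_eq_zero fun v _ => Finset.sum_eq_zero fun h _ => ?_
    rw [if_neg]
    rintro ⟨h1, -⟩
    exact hne h1

theorem sum_edgeLabels (lam : YoungDiagram) (L : ℕ) (hL : lam.colLen 0 ≤ L) :
    ∑ c, edgeLabels lam L c = lam.rowLen 0 := by
  have h : ∀ k, ∑ c ∈ Finset.range k, (lam.rowLen c - lam.rowLen (c + 1)) + lam.rowLen k =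
      lam.rowLen 0 := by
    intro k
    induction k with
    | zero => simp
    | succ k ih =>
      rw [Finset.sum_range_succ]
      have := lam.rowLen_anti k (k + 1) (Nat.le_succ k)
      omega
  have h1 := h L
  rw [(rowLen_eq_zero_iff lam L).2 hL, add_zero, ← Fin.sum_univ_eq_sum_range] at h1
  exact h1

/-- Summing the conservation law over all vertices cancels the internal edges and leaves the balance
of boundary labels, with the right edges contributing 0. -/
theorem gridSum_eq_zero (N : ℕ) {n L : ℕ} (w : Fin n → Fin L → ℕ → ℕ → ℕ → ℕ → K)
    (hw : ∀ r c i j k l, i + j ≠ k + l → w r c i j k l = 0)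
    (a : Fin n → ℕ) (bot top : Fin L → ℕ) (h : ∑ r, a r + ∑ c, bot c ≠ ∑ c, top c) :
    gridSum N w a bot top = 0 := by
  refine Finset.sum_eq_zero fun v _ => Finset.sum_eq_zero fun x _ => ?_
  split_ifs with hc
  · obtain ⟨h0, h1, h2, h3⟩ := hc
    by_contra hne
    apply h
    have hcons : ∀ r c, v r.succ c + x r c.castSucc = v r.castSucc c + x r c.succ := by
      intro r c
      by_contra hrc
      exact hne (Finset.prod_eq_zero (Finset.mem_univ r)
        (Finset.prod_eq_zero (Finset.mem_univ c) (hw r c _ _ _ _ hrc)))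
    have hsum : ∑ r, ∑ c, (v r.succ c + x r c.castSucc) =
        ∑ r, ∑ c, (v r.castSucc c + x r c.succ) :=
      Finset.sum_congr rfl fun r _ => Finset.sum_congr rfl fun c _ => hcons r c
    simp only [Finset.sum_add_distrib] at hsum
    have hv1 := Fin.sum_univ_succ (fun r => ∑ c, v r c)
    have hv2 := Fin.sum_univ_castSucc (fun r => ∑ c, v r c)
    have hx1 : ∀ r, ∑ c, x r c = x r 0 + ∑ c : Fin L, x r c.succ :=
      fun r => Fin.sum_univ_succ _
    have hx2 : ∀ r, ∑ c, x r c = ∑ c : Fin L, x r c.castSucc + x r (Fin.last L) :=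
      fun r => Fin.sum_univ_castSucc _
    have hx3 : ∑ r, a r + ∑ r, ∑ c : Fin L, x r c.succ = ∑ r, ∑ c : Fin L, x r c.castSucc := by
      rw [← Finset.sum_add_distrib]
      refine Finset.sum_congr rfl fun r _ => ?_
      rw [← h2 r, ← hx1, hx2, h3, add_zero]
    rw [h0] at hv1
    rw [h1] at hv2
    omega
  · rfl

/-! ### The kernel of a single row -/

open Classical in
/-- The weight of the row with top labels `m_j(λ')` and bottom labels `m_j(μ')`, including a weight
`b` of the label of its left edge. -/
noncomputable def rowKernel (b : ℕ → K) (w : ℕ → ℕ → ℕ → ℕ → ℕ → K)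
    (lam mu : YoungDiagram) : K :=
  if mu ≤ lam then
    b (lam.rowLen 0 - mu.rowLen 0) *
      ∏ c ∈ Finset.range (lam.colLen 0),
        w c (mu.rowLen c - mu.rowLen (c + 1)) (lam.rowLen c - mu.rowLen c)
          (lam.rowLen c - lam.rowLen (c + 1)) (lam.rowLen (c + 1) - mu.rowLen (c + 1))
  else 0

theorem isLower_rowKernel (b : ℕ → K) (w : ℕ → ℕ → ℕ → ℕ → ℕ → K) : IsLower (rowKernel b w) := by
  intro lam mu h
  by_contra hc
  exact h (if_neg hc)

theorem rowKernel_of_le (b : ℕ → K) (w : ℕ → ℕ → ℕ → ℕ → ℕ → K) (hw : ∀ c, w c 0 0 0 0 = 1)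
    (lam mu : YoungDiagram) (h : mu ≤ lam) (L : ℕ) (hL : lam.colLen 0 ≤ L) :
    rowKernel b w lam mu = b (lam.rowLen 0 - mu.rowLen 0) *
      ∏ c ∈ Finset.range L,
        w c (mu.rowLen c - mu.rowLen (c + 1)) (lam.rowLen c - mu.rowLen c)
          (lam.rowLen c - lam.rowLen (c + 1)) (lam.rowLen (c + 1) - mu.rowLen (c + 1)) := by
  rw [rowKernel, if_pos h]
  congr 1
  refine Finset.prod_subset (Finset.range_subset_range.2 hL) fun c _ hc => ?_
  rw [Finset.mem_range, not_lt] at hc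
  have h0 := (rowLen_eq_zero_iff lam c).2 hc
  have h1 := (rowLen_eq_zero_iff lam (c + 1)).2 (by omega)
  have h2 := (le_iff_rowLen_le mu lam).1 h c
  have h3 := (le_iff_rowLen_le mu lam).1 h (c + 1)
  rw [h0, h1, show mu.rowLen c = 0 by omega, show mu.rowLen (c + 1) = 0 by omega]
  exact hw c

-- Starting from the right edge, where the label is 0, conservation determines the horizontal labels
-- one by one as `λ_c - μ_c`. Hence at most one configuration contributes, and nonnegativity of the
-- labels is containment of the diagrams.
open Classical in
theorem rowSum_edgeLabels (N L : ℕ) (w : ℕ → ℕ → ℕ → ℕ → ℕ → K)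
    (hw : ∀ c i j k l, i + j ≠ k + l → w c i j k l = 0) (a : ℕ) (lam mu : YoungDiagram)
    (hlam : lam.colLen 0 ≤ L) (hmu : mu.colLen 0 ≤ L) (hN : lam.rowLen 0 < N) :
    rowSum N (fun c : Fin L => w c) a (edgeLabels mu L) (edgeLabels lam L) =
      if mu ≤ lam ∧ lam.rowLen 0 = mu.rowLen 0 + a then
        ∏ c ∈ Finset.range L,
          w c (mu.rowLen c - mu.rowLen (c + 1)) (lam.rowLen c - mu.rowLen c)
            (lam.rowLen c - lam.rowLen (c + 1)) (lam.rowLen (c + 1) - mu.rowLen (c + 1))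
      else 0 := by
  have key : ∀ h : Fin (L + 1) → ℕ, (if h 0 = a ∧ h (Fin.last L) = 0 then
      ∏ c : Fin L, w c (edgeLabels mu L c) (h c.castSucc) (edgeLabels lam L c) (h c.succ)
      else 0) ≠ 0 → h 0 = a ∧ ∀ c : Fin (L + 1), h c + mu.rowLen c = lam.rowLen c := by
    intro h hne
    split_ifs at hne with hc
    · refine ⟨hc.1, fun c => ?_⟩
      induction c using Fin.reverseInduction with
      | last =>
        rw [hc.2, Fin.val_last, (rowLen_eq_zero_iff lam L).2 hlam,
          (rowLen_eq_zero_iff mu L).2 hmu]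
      | cast c ih =>
        have h1 : edgeLabels mu L c + h c.castSucc = edgeLabels lam L c + h c.succ := by
          by_contra hcc
          exact hne (Finset.prod_eq_zero (Finset.mem_univ c) (hw c _ _ _ _ hcc))
        simp only [edgeLabels] at h1
        rw [Fin.val_succ] at ih
        rw [Fin.val_castSucc]
        have h2 := lam.rowLen_anti c (c + 1) (Nat.le_succ _)
        have h3 := mu.rowLen_anti c (c + 1) (Nat.le_succ _)
        omega
    · exact absurd rfl hne
  split_ifs with hc
  · obtain ⟨hle, ha⟩ := hc
    rw [le_iff_rowLen_le] at hle
    rw [rowSum, Finset.sum_eq_single_of_mem (fun c : Fin (L + 1) => lam.rowLen c - mu.rowLen c)]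
    · rw [if_pos, ← Fin.prod_univ_eq_prod_range (fun c =>
        w c (mu.rowLen c - mu.rowLen (c + 1)) (lam.rowLen c - mu.rowLen c)
          (lam.rowLen c - lam.rowLen (c + 1)) (lam.rowLen (c + 1) - mu.rowLen (c + 1)))]
      · rfl
      · simp only [Fin.val_zero, Fin.val_last]
        have := (rowLen_eq_zero_iff lam L).2 hlam
        omega
    · rw [Fintype.mem_piFinset]
      intro c
      have := lam.rowLen_anti 0 c (Nat.zero_le _)
      rw [Finset.mem_range]
      omega
    · intro h _ hne
      by_contra hne'
      refine hne (funext fun c => ?_)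
      have := (key h hne').2 c
      omega
  · refine Finset.sum_eq_zero fun h _ => ?_
    by_contra hne
    obtain ⟨h1, h2⟩ := key h hne
    refine hc ⟨(le_iff_rowLen_le _ _).2 fun i => ?_, ?_⟩
    · by_cases hi : i < L + 1
      · have := h2 ⟨i, hi⟩
        dsimp only at this
        omega
      · rw [(rowLen_eq_zero_iff mu i).2 (by omega)]
        exact Nat.zero_le _
    · have := h2 0
      rw [Fin.val_zero] at this
      omega

theorem eq_of_edgeLabels_eq {lam mu : YoungDiagram} {L : ℕ} (hlam : lam.colLen 0 ≤ L)
    (hmu : mu.colLen 0 ≤ L) (h : edgeLabels lam L = edgeLabels mu L) : lam = mu := by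
  have key : ∀ c : Fin (L + 1), lam.rowLen c = mu.rowLen c := by
    intro c
    induction c using Fin.reverseInduction with
    | last =>
      rw [Fin.val_last, (rowLen_eq_zero_iff lam L).2 hlam, (rowLen_eq_zero_iff mu L).2 hmu]
    | cast c ih =>
      have h1 := congrFun h c
      simp only [edgeLabels] at h1
      rw [Fin.val_succ] at ih
      rw [Fin.val_castSucc]
      have h2 := lam.rowLen_anti c (c + 1) (Nat.le_succ _)
      have h3 := mu.rowLen_anti c (c + 1) (Nat.le_succ _)
      omega
  refine eq_of_rowLen_eq fun i => ?_
  by_cases hi : i < L + 1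
  · exact key ⟨i, hi⟩
  · rw [(rowLen_eq_zero_iff lam i).2 (by omega), (rowLen_eq_zero_iff mu i).2 (by omega)]

theorem exists_edgeLabels_eq {L : ℕ} (f : Fin L → ℕ) :
    ∃ lam : YoungDiagram, lam.colLen 0 ≤ L ∧ edgeLabels lam L = f := by
  -- Parts are the tail sums of the prescribed differences.
  let F : ℕ → ℕ := fun i => ∑ c : Fin L, if i ≤ c then f c else 0
  have hanti : Antitone F := by
    intro i j hij
    refine Finset.sum_le_sum fun c _ => ?_
    split_ifs <;> omega
  obtain ⟨lam, h1, h2⟩ := exists_rowLen_eq F hanti L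
    (Finset.sum_eq_zero fun c _ => if_neg (by have := c.2; omega))
  refine ⟨lam, h2, funext fun c => ?_⟩
  have hstep : F c = F (c + 1) + f c := by
    have h3 : f c = ∑ d : Fin L, if d = c then f d else 0 := by simp
    simp only [F]
    rw [h3, ← Finset.sum_add_distrib]
    refine Finset.sum_congr rfl fun d _ => ?_
    by_cases hd : d = c
    · subst hd
      simp
    · have : (d : ℕ) ≠ c := fun h => hd (Fin.ext h)
      rw [if_neg hd]
      split_ifs <;> omega
  simp only [edgeLabels, h1]
  omega

theorem edgeLabels_le (lam : YoungDiagram) (L : ℕ) (c : Fin L) :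
    edgeLabels lam L c ≤ lam.rowLen 0 := by
  have := lam.rowLen_anti 0 c (Nat.zero_le _)
  simp only [edgeLabels]
  omega

/-- The partition function with weighted left edges is a composition of row kernels. -/
theorem sum_gridSum_eq_kernelIter (n N L : ℕ) (A : Finset ℕ) (b : ℕ → ℕ → K)
    (w : ℕ → ℕ → ℕ → ℕ → ℕ → ℕ → K)
    (hw : ∀ r c i j k l, i + j ≠ k + l → w r c i j k l = 0)
    (hw0 : ∀ r c, w r c 0 0 0 0 = 1)
    (hA : ∀ r lam mu, rowKernel (b r) (w r) lam mu ≠ 0 → lam.rowLen 0 < N →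
      lam.rowLen 0 - mu.rowLen 0 ∈ A)
    (lam mu : YoungDiagram) (hlam : lam.colLen 0 ≤ L) (hmu : mu.colLen 0 ≤ L)
    (hN : lam.rowLen 0 < N) :
    ∑ a ∈ Fintype.piFinset (fun _ : Fin n => A), (∏ r : Fin n, b r (a r)) *
        gridSum N (fun (r : Fin n) (c : Fin L) => w r c) a (edgeLabels mu L) (edgeLabels lam L) =
      kernelIter n (fun r => rowKernel (b r) (w r)) lam mu := by
  induction n generalizing b w lam with
  | zero =>
    have hmem : edgeLabels lam L ∈ Fintype.piFinset (fun _ : Fin L => Finset.range N) :=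
      Fintype.mem_piFinset.2 fun c =>
        Finset.mem_range.2 ((edgeLabels_le lam L c).trans_lt hN)
    have hiff : edgeLabels lam L = edgeLabels mu L ↔ lam = mu :=
      ⟨eq_of_edgeLabels_eq hlam hmu, fun h => by rw [h]⟩
    simp only [kernelIter, kernelOne]
    rw [sum_piFinset_zero, gridSum_zero N _ _ _ _ hmem, Finset.prod_of_isEmpty, one_mul]
    by_cases h : lam = mu
    · rw [if_pos h, if_pos (hiff.2 h)]
    · rw [if_neg h, if_neg fun h' => h (hiff.1 h')]
  | succ n ih =>
    have htop : ∀ c, edgeLabels lam L c < N := fun c =>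
      (edgeLabels_le lam L c).trans_lt hN
    simp only [gridSum_succ N _ _ _ _ htop]
    rw [sum_piFinset_cons, kernelIter, kernelComp]
    simp only [Fin.prod_univ_succ, Fin.cons_zero, Fin.cons_succ, Fin.val_zero, Fin.val_succ]
    symm
    calc _ = ∑ mid ∈ Fintype.piFinset (fun _ : Fin L => Finset.range N),
          (∑ x ∈ A, b 0 x * rowSum N (fun c : Fin L => w 0 c) x mid (edgeLabels lam L)) *
          ∑ a ∈ Fintype.piFinset (fun _ : Fin n => A), (∏ r : Fin n, b (r + 1) (a r)) *
            gridSum N (fun (r : Fin n) (c : Fin L) => w (r + 1) c) a (edgeLabels mu L) mid := ?_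
      _ = _ := ?_
    -- The sum over the left label keeps only the value `λ_1 - ρ_1`; when this is outside `A`,
    -- hypothesis `hA` makes the kernel vanish.
    · have hrow : ∀ rho : YoungDiagram, rho.colLen 0 ≤ L →
          ∑ x ∈ A, b 0 x * rowSum N (fun c : Fin L => w 0 c) x (edgeLabels rho L)
            (edgeLabels lam L) = rowKernel (b 0) (w 0) lam rho := by
        intro rho hrho
        by_cases hle : rho ≤ lam
        · have h0 := (le_iff_rowLen_le _ _).1 hle 0
          have hval := rowKernel_of_le (b 0) (w 0) (hw0 0) lam rho hle L hlam
          have hterm : ∀ x, b 0 x * rowSum N (fun c : Fin L => w 0 c) x (edgeLabels rho L)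
              (edgeLabels lam L) = if lam.rowLen 0 - rho.rowLen 0 = x then
                rowKernel (b 0) (w 0) lam rho else 0 := by
            intro x
            rw [rowSum_edgeLabels N L (w 0) (hw 0) x lam rho hlam hrho hN]
            by_cases hx : lam.rowLen 0 - rho.rowLen 0 = x
            · rw [if_pos ⟨hle, by omega⟩, if_pos hx, hval, hx]
            · rw [if_neg (by rintro ⟨-, h⟩; omega), if_neg hx, mul_zero]
          simp only [hterm]
          rw [Finset.sum_ite_eq]
          split_ifs with hmem
          · rfl
          · by_contra hne
            exact hmem (hA 0 lam rho (Ne.symm hne) hN)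
        · rw [rowKernel, if_neg hle]
          refine Finset.sum_eq_zero fun x _ => ?_
          rw [rowSum_edgeLabels N L (w 0) (hw 0) x lam rho hlam hrho hN,
            if_neg fun h => hle h.1, mul_zero]
      have hterm : ∀ rho : YoungDiagram, rho ≤ lam →
          (∑ x ∈ A, b 0 x * rowSum N (fun c : Fin L => w 0 c) x (edgeLabels rho L)
            (edgeLabels lam L)) *
          ∑ a ∈ Fintype.piFinset (fun _ : Fin n => A), (∏ r : Fin n, b (r + 1) (a r)) *
            gridSum N (fun (r : Fin n) (c : Fin L) => w (r + 1) c) a (edgeLabels mu L)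
              (edgeLabels rho L) =
          rowKernel (b 0) (w 0) lam rho *
            kernelIter n (fun r => rowKernel (b (r + 1)) (w (r + 1))) rho mu := by
        intro rho hle
        have hrho := (colLen_mono hle).trans hlam
        rw [hrow rho hrho, ih (fun r => b (r + 1)) (fun r => w (r + 1)) (fun r => hw (r + 1))
          (fun r => hw0 (r + 1)) (fun r => hA (r + 1)) rho hrho
          (lt_of_le_of_lt ((le_iff_rowLen_le _ _).1 hle 0) hN)]
      -- Sequences of `L` edge labels are the same as partitions of length at most `L`, so the sum
      -- over labels is the sum defining the composition.
      refine finsum_eq_sum_of_bij _ _ _ (fun rho => edgeLabels rho L) ?_ ?_ ?_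
      · intro rho hne
        have hle := isLower_rowKernel _ _ _ _ (left_ne_zero_of_mul hne)
        refine ⟨Fintype.mem_piFinset.2 fun c => Finset.mem_range.2 ?_, hterm rho hle⟩
        have h1 := edgeLabels_le rho L c
        have h2 := (le_iff_rowLen_le _ _).1 hle 0
        omega
      · intro rho sig h1 h2 h3
        have hle1 := isLower_rowKernel _ _ _ _ (left_ne_zero_of_mul h1)
        have hle2 := isLower_rowKernel _ _ _ _ (left_ne_zero_of_mul h2)
        exact eq_of_edgeLabels_eq ((colLen_mono hle1).trans hlam) ((colLen_mono hle2).trans hlam) h3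
      · intro mid _ hne
        obtain ⟨rho, hrho, rfl⟩ := exists_edgeLabels_eq mid
        have hle : rho ≤ lam := by
          have h1 := left_ne_zero_of_mul hne
          rw [hrow rho hrho] at h1
          exact isLower_rowKernel _ _ _ _ h1
        exact ⟨rho, by rwa [← hterm rho hle], rfl⟩
    · simp only [Finset.sum_mul, Finset.mul_sum]
      rw [Finset.sum_comm]
      refine Eq.trans ?_ Finset.sum_comm
      refine Finset.sum_congr rfl fun a _ => ?_
      rw [Finset.sum_comm]
      exact Finset.sum_congr rfl fun x _ => Finset.sum_congr rfl fun mid _ => by ring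

/-! ### The intertwining relation for a single column -/

/-- The weight `w_{u;s}` in terms of `x = s u` and `y = s ^ 2`. -/
def hsWeightSq (q x y : K) (i j k l : ℕ) : K :=
  if i + j = k + l then
    match j, l with
    | 0, 0 => (1 - x * q ^ i) / (1 - x)
    | 0, 1 => (q ^ i - 1) * x / (1 - x)
    | 1, 0 => (1 - y * q ^ i) / (1 - x)
    | 1, 1 => (y * q ^ i - x) / (1 - x)
    | _, _ => 0
  else 0

theorem hsWeight_eq (q u s : K) : hsWeight q u s = hsWeightSq q (s * u) (s ^ 2) := rfl

/-- The factor `κ^a (P/κ;q)_a / (q;q)_a` with `a = x - m`, or zero if `a` is negative. -/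
def hF (q κ P : K) (x m : ℕ) : K :=
  if m ≤ x then qPochHom q κ P (x - m) / qPoch q q (x - m) else 0

/-- The factor `(κ R;q)_a / (q;q)_a` with `a = m - x`, or zero if `a` is negative. -/
def hG (q κ R : K) (m x : ℕ) : K :=
  if x ≤ m then qPoch q (κ * R) (m - x) / qPoch q q (m - x) else 0

/-- The weight of a vertex of the added vertical strip, up to a gauge factor. -/
def leftW (u P R : K) (ε ε' : ℕ) (X : K) : K :=
  match ε, ε' with
  | 0, 0 => 1 - u * P * X
  | 0, _ + 1 => -u * (1 - P * R * X)
  | _ + 1, 0 => 1 - X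
  | _ + 1, _ + 1 => R * X - u

/-- The weight of a vertex of the removed vertical strip, up to a gauge factor. -/
def rightW (u P R : K) (ε ε' : ℕ) (X : K) : K :=
  match ε, ε' with
  | 0, 0 => 1 - u * P * X
  | 0, _ + 1 => u * (X - 1)
  | _ + 1, 0 => 1 - P * R * X
  | _ + 1, _ + 1 => R * X - u

/-- The transfer matrix of a column on the left hand side of the Cauchy identity. -/
def leftT (q κ u P P' R : K) (n n' m m' ε ε' : ℕ) : K :=
  leftW u P R ε ε' (q ^ (n + ε - (n' + ε'))) * hF q κ P' (n' + ε') m' * hG q κ R m (n' + ε')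

/-- The transfer matrix of a column on the right hand side of the Cauchy identity. -/
def rightT (q κ u P' R : K) (n' m m' ε ε' : ℕ) : K :=
  rightW u P' R ε ε' (q ^ (m + ε' - (m' + ε))) * hF q κ P' (n' + ε') m' * hG q κ R m (n' + ε)

/-- The relation between the partial sums of both sides of the Cauchy identity. -/
def Intertwined (q κ u P : K) (n m : ℕ) (V V' : ℕ → K) : Prop :=
  (m ≤ n → V 0 = (1 - u * P * q ^ (n - m)) * V' 0 - u * (κ - P * q ^ (n - m)) * V' 1 ∧
    V 1 = (1 - q ^ (n - m + 1)) * V' 0 + (q ^ (n - m + 1) - u * κ) * V' 1) ∧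
  (m = n + 1 → V 1 = (1 - u * κ) * V' 1)

/-! ### Recursions for the factors, and the exchange relation. -/

theorem qPoch_succ (q x : K) (n : ℕ) : qPoch q x (n + 1) = qPoch q x n * (1 - x * q ^ n) :=
  Finset.prod_range_succ _ _

theorem qPoch_self_ne_zero (q : K) (hq : ∀ k : ℕ, 1 ≤ k → q ^ k ≠ 1) (n : ℕ) :
    qPoch q q n ≠ 0 := by
  refine Finset.prod_ne_zero_iff.2 fun r _ => ?_
  rw [← pow_succ', sub_ne_zero]
  exact (hq (r + 1) (by omega)).symm

theorem hF_of_lt (q κ P : K) {x m : ℕ} (h : x < m) : hF q κ P x m = 0 := if_neg (by omega)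

theorem hG_of_lt (q κ R : K) {m x : ℕ} (h : m < x) : hG q κ R m x = 0 := if_neg (by omega)

theorem hF_self (q κ P : K) (x : ℕ) : hF q κ P x x = 1 := by simp [hF, qPochHom, qPoch]

theorem hF_succ (q κ P : K) (hq : ∀ k : ℕ, 1 ≤ k → q ^ k ≠ 1) (m e : ℕ) :
    hF q κ P (m + e + 1) m = hF q κ P (m + e) m * (κ - P * q ^ e) / (1 - q ^ (e + 1)) := by
  rw [hF, hF, if_pos (by omega), if_pos (by omega), show m + e + 1 - m = e + 1 by omega,
    show m + e - m = e by omega, qPoch_succ, qPochHom, Finset.prod_range_succ, ← qPochHom,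
    ← pow_succ']
  have h1 := qPoch_self_ne_zero q hq e
  have h2 : 1 - q ^ (e + 1) ≠ 0 := sub_ne_zero.2 (hq _ (by omega)).symm
  field_simp

theorem hG_succ (q κ R : K) (hq : ∀ k : ℕ, 1 ≤ k → q ^ k ≠ 1) (x k : ℕ) :
    hG q κ R (x + 1 + k) x =
      hG q κ R (x + 1 + k) (x + 1) * (1 - κ * R * q ^ k) / (1 - q ^ (k + 1)) := by
  rw [hG, hG, if_pos (by omega), if_pos (by omega), show x + 1 + k - x = k + 1 by omega,
    show x + 1 + k - (x + 1) = k by omega, qPoch_succ, qPoch_succ, ← pow_succ']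
  have h1 := qPoch_self_ne_zero q hq k
  have h2 : 1 - q ^ (k + 1) ≠ 0 := sub_ne_zero.2 (hq _ (by omega)).symm
  field_simp

/-- The exchange relation: left transfer matrix times the intertwiner of the next column equals the
intertwiner of this column times the right transfer matrix. The recursions for `hF` and `hG` reduce
all entries to a common factor, leaving polynomial identities in powers of `q`. The truncated
exponents in `leftT` are harmless: `hG` forces `n' + ε' ≤ m`, and `Intertwined` constrains component
`ε` only when `m ≤ n + ε`. Those in `rightT` are controlled by both `hF` and `hG`. -/
theorem Intertwined.step {q κ u P P' R : K} (hq : ∀ k : ℕ, 1 ≤ k → q ^ k ≠ 1) {n n' m m' : ℕ}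
    {V V' : ℕ → K} (h : Intertwined q κ u P' n' m' V V') :
    Intertwined q κ u P n m
      (fun ε => ∑ ε' ∈ Finset.range 2, leftT q κ u P P' R n n' m m' ε ε' * V ε')
      (fun ε => ∑ ε' ∈ Finset.range 2, rightT q κ u P' R n' m m' ε ε' * V' ε') := by
  obtain ⟨hV, hV1⟩ := h
  simp only [Intertwined, Finset.sum_range_succ, Finset.sum_range_zero, zero_add, leftT, rightT,
    leftW, rightW, add_zero]
  -- All entries vanish unless `n' ≤ m` and `m' ≤ n' + 1`. The boundary cases `m' = n' + 1` and `m =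
  -- n'` are separate because there a component drops out.
  rcases lt_or_ge m n' with hm | hm
  · have h0 := hG_of_lt q κ R hm
    have h1 := hG_of_lt q κ R (show m < n' + 1 by omega)
    simp [h0, h1]
  rcases lt_or_ge (n' + 1) m' with hm' | hm'
  · have h0 := hF_of_lt q κ P' hm'
    have h1 := hF_of_lt q κ P' (show n' < m' by omega)
    simp [h0, h1]
  rcases Nat.eq_or_lt_of_le hm' with hm' | hm'
  · subst hm'
    have h0 := hF_of_lt q κ P' (show n' < n' + 1 by omega)
    rw [h0, hF_self, hV1 rfl]
    obtain ⟨k, rfl⟩ := Nat.exists_eq_add_of_le hm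
    rcases k with _ | k
    · have h1 := hG_of_lt q κ R (show n' + 0 < n' + 1 by omega)
      rw [h1]
      constructor
      · intro _
        simp
      · intro _
        simp
    · rw [show n' + (k + 1) = n' + 1 + k by omega, hG_succ q κ R hq]
      have h2 : 1 - q ^ (k + 1) ≠ 0 := sub_ne_zero.2 (hq _ (by omega)).symm
      constructor
      · intro hn
        obtain ⟨d, rfl⟩ := Nat.exists_eq_add_of_le hn
        rw [show n' + 1 + k + d - (n' + 1) = k + d by omega,
          show n' + 1 + k + d + 1 - (n' + 1) = k + d + 1 by omega,
          show n' + 1 + k + d - (n' + 1 + k) = d by omega,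
          show n' + 1 + k + 1 - (n' + 1) = k + 1 by omega,
          show n' + 1 + k + 1 - (n' + 1 + 1) = k by omega]
        constructor
        · field_simp
          ring
        · field_simp
          ring
      · intro hn
        rw [show n + 1 - (n' + 1) = k by omega, show n' + 1 + k + 1 - (n' + 1 + 1) = k by omega]
        ring
  · obtain ⟨e, rfl⟩ := Nat.exists_eq_add_of_le (Nat.lt_succ_iff.1 hm')
    obtain ⟨k, rfl⟩ := Nat.exists_eq_add_of_le hm
    obtain ⟨h0, h1⟩ := hV (by omega)
    rw [h0, h1, hF_succ q κ P' hq, show m' + e - m' = e by omega]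
    have h3 : 1 - q ^ (e + 1) ≠ 0 := sub_ne_zero.2 (hq _ (by omega)).symm
    rcases k with _ | k
    · have h1 := hG_of_lt q κ R (show m' + e + 0 < m' + e + 1 by omega)
      rw [h1]
      constructor
      · intro hn
        obtain ⟨d, rfl⟩ := Nat.exists_eq_add_of_le hn
        rw [show m' + e + 0 + d - (m' + e) = d by omega,
          show m' + e + 0 + d + 1 - (m' + e) = d + 1 by omega,
          show m' + e + 0 + d - (m' + e + 0) = d by omega,
          show m' + e + 0 - m' = e by omega,
          show m' + e + 0 + 1 - m' = e + 1 by omega]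
        constructor
        · field_simp
          ring
        · field_simp
          ring
      · intro hn
        rw [show n + 1 - (m' + e) = 0 by omega]
        ring
    · rw [show m' + e + (k + 1) = m' + e + 1 + k by omega, hG_succ q κ R hq]
      have h2 : 1 - q ^ (k + 1) ≠ 0 := sub_ne_zero.2 (hq _ (by omega)).symm
      constructor
      · intro hn
        obtain ⟨d, rfl⟩ := Nat.exists_eq_add_of_le hn
        rw [show m' + e + 1 + k + d - (m' + e) = k + d + 1 by omega,
          show m' + e + 1 + k + d - (m' + e + 1) = k + d by omega,
          show m' + e + 1 + k + d + 1 - (m' + e) = k + d + 2 by omega,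
          show m' + e + 1 + k + d + 1 - (m' + e + 1) = k + d + 1 by omega,
          show m' + e + 1 + k + d - (m' + e + 1 + k) = d by omega,
          show m' + e + 1 + k - m' = e + k + 1 by omega,
          show m' + e + 1 + k + 1 - m' = e + k + 2 by omega,
          show m' + e + 1 + k - (m' + 1) = e + k by omega,
          show m' + e + 1 + k + 1 - (m' + 1) = e + k + 1 by omega]
        constructor
        · field_simp
          ring
        · field_simp
          ring
      · intro hn
        rw [show n + 1 - (m' + e) = k + 1 by omega, show n + 1 - (m' + e + 1) = k by omega,
          show m' + e + 1 + k - (m' + 1) = e + k by omega,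
          show m' + e + 1 + k + 1 - (m' + 1) = e + k + 1 by omega]
        field_simp
        ring

/-- The weights of the left edge form a left eigenvector of the intertwiner with eigenvalue `1 - u *
κ`. If `m = n + 1` only the second component has nonzero weight, and it is already scaled by this
eigenvalue. -/
theorem Intertwined.left_sum {q κ u P : K} (hq : ∀ k : ℕ, 1 ≤ k → q ^ k ≠ 1) {n m : ℕ}
    {V V' : ℕ → K} (h : Intertwined q κ u P n m V V') :
    ∑ ε ∈ Finset.range 2, (-u) ^ ε * hF q κ P (n + ε) m * V ε =
      (1 - u * κ) * ∑ ε ∈ Finset.range 2, (-u) ^ ε * hF q κ P (n + ε) m * V' ε := by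
  obtain ⟨hV, hV1⟩ := h
  simp only [Finset.sum_range_succ, Finset.sum_range_zero, zero_add, add_zero, pow_zero, pow_one]
  rcases lt_or_ge (n + 1) m with hm' | hm'
  · rw [hF_of_lt q κ P hm', hF_of_lt q κ P (show n < m by omega)]
    ring
  rcases Nat.eq_or_lt_of_le hm' with hm' | hm'
  · rw [hF_of_lt q κ P (show n < m by omega), hV1 hm']
    ring
  · obtain ⟨e, rfl⟩ := Nat.exists_eq_add_of_le (Nat.lt_succ_iff.1 hm')
    obtain ⟨h0, h1⟩ := hV (by omega)
    rw [h0, h1, hF_succ q κ P hq, show m + e - m = e by omega]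
    have h3 : 1 - q ^ (e + 1) ≠ 0 := sub_ne_zero.2 (hq _ (by omega)).symm
    field_simp
    ring

/-! ### Products of transfer matrices along the columns. -/

/-- The product of the transfer matrices `T 0, …, T (k - 1)` applied to the vector `e`. -/
def chainVec (e : ℕ → K) : ℕ → (ℕ → ℕ → ℕ → K) → ℕ → K
  | 0, _ => e
  | k + 1, T => fun x =>
      ∑ y ∈ Finset.range 2, T 0 x y * chainVec e k (fun c => T (c + 1)) y

theorem sum_chain (f e : ℕ → K) (k : ℕ) (T : ℕ → ℕ → ℕ → K) :
    ∑ y ∈ Fintype.piFinset (fun _ : Fin (k + 1) => Finset.range 2),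
        f (y 0) * (∏ c : Fin k, T c (y c.castSucc) (y c.succ)) * e (y (Fin.last k)) =
      ∑ x ∈ Finset.range 2, f x * chainVec e k T x := by
  induction k generalizing f T with
  | zero =>
    rw [sum_piFinset_cons]
    refine Finset.sum_congr rfl fun x _ => ?_
    rw [sum_piFinset_zero, Finset.prod_of_isEmpty, mul_one]
    rfl
  | succ k ih =>
    rw [sum_piFinset_cons]
    refine Finset.sum_congr rfl fun x _ => ?_
    simp only [chainVec]
    rw [← ih (fun y => T 0 x y) (fun c => T (c + 1)), Finset.mul_sum]
    refine Finset.sum_congr rfl fun y _ => ?_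
    rw [Fin.prod_univ_succ, ← Fin.succ_last]
    simp only [Fin.cons_zero, Fin.cons_succ, ← Fin.succ_castSucc, Fin.castSucc_zero, Fin.val_zero,
      Fin.val_succ]
    ring

theorem intertwined_chain {q κ u : K} (hq : ∀ k : ℕ, 1 ≤ k → q ^ k ≠ 1) (L : ℕ) (p r : ℕ → K)
    (n m : ℕ → ℕ) (e e' : ℕ → K) (he : Intertwined q κ u (p L) (n L) (m L) e e') :
    Intertwined q κ u (p 0) (n 0) (m 0)
      (chainVec e L fun c => leftT q κ u (p c) (p (c + 1)) (r c) (n c) (n (c + 1)) (m c)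
        (m (c + 1)))
      (chainVec e' L fun c => rightT q κ u (p (c + 1)) (r c) (n (c + 1)) (m c) (m (c + 1))) := by
  induction L generalizing p r n m with
  | zero => exact he
  | succ L ih =>
    exact Intertwined.step hq (ih (fun c => p (c + 1)) (fun c => r (c + 1)) (fun c => n (c + 1))
      (fun c => m (c + 1)) he)

/-! ### The functions in one variable -/

/-- The factor `(y;q)_i / (q;q)_i`. -/
def qRatio (q y : K) (i : ℕ) : K := qPoch q y i / qPoch q q i

/-- The factor `c_S(λ)` in terms of the squares `y` of `S`. -/
def cNormSq (q : K) (y : ℕ → K) (lam : YoungDiagram) : K :=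
  ∏ i ∈ Finset.range (lam.colLen 0), qRatio q (y (i + 1)) (lam.rowLen i - lam.rowLen (i + 1))

/-- The monomial `∏_{i ≥ 1} y_{i-1}^{λ_i}`. -/
def powParts (y : ℕ → K) (lam : YoungDiagram) : K :=
  ∏ i ∈ Finset.range (lam.colLen 0), y i ^ lam.rowLen i

/-- The spin `q`-Whittaker function in one variable, in the stochastic normalization, with
`p i = S i * Ξ i` and `r i = S i / Ξ i`. -/
noncomputable def qwKernel (q κ : K) (p r : ℕ → K) : YoungDiagram → YoungDiagram → K :=
  rowKernel (fun a => r 0 ^ a * qPochHom q κ (p 1) a / qPoch q q a)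
    (fun c => qHahnWeightPoly q κ (p (c + 2)) (p (c + 2) * r (c + 1)))

/-- The stable spin Hall-Littlewood function in one variable, in the stochastic normalization, with
`p i = S i * Ξ i` and `r i = S i / Ξ i`. -/
noncomputable def hlKernel (q u : K) (p r : ℕ → K) : YoungDiagram → YoungDiagram → K :=
  rowKernel (fun a => (-(u * p 0)) ^ a)
    (fun c => hsWeightSq q (u * p (c + 1)) (p (c + 1) * r (c + 1)))

theorem cNormSq_eq_prod (q : K) (y : ℕ → K) (lam : YoungDiagram) (L : ℕ)
    (hL : lam.colLen 0 ≤ L) :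
    cNormSq q y lam =
      ∏ i ∈ Finset.range L, qRatio q (y (i + 1)) (lam.rowLen i - lam.rowLen (i + 1)) := by
  refine Finset.prod_subset (Finset.range_subset_range.2 hL) fun c _ hc => ?_
  rw [Finset.mem_range, not_lt] at hc
  rw [(rowLen_eq_zero_iff lam c).2 hc]
  simp [qRatio, qPoch]

theorem powParts_eq_prod (y : ℕ → K) (lam : YoungDiagram) (L : ℕ) (hL : lam.colLen 0 ≤ L) :
    powParts y lam = ∏ i ∈ Finset.range L, y i ^ lam.rowLen i := by
  refine Finset.prod_subset (Finset.range_subset_range.2 hL) fun c _ hc => ?_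
  rw [Finset.mem_range, not_lt] at hc
  rw [(rowLen_eq_zero_iff lam c).2 hc, pow_zero]

theorem qPoch_ne_zero {q y : K} (hy : ∀ k : ℕ, y * q ^ k ≠ 1) (n : ℕ) : qPoch q y n ≠ 0 :=
  Finset.prod_ne_zero_iff.2 fun r _ => sub_ne_zero.2 (hy r).symm

theorem cNormSq_ne_zero {q : K} (hq : ∀ k : ℕ, 1 ≤ k → q ^ k ≠ 1) {y : ℕ → K}
    (hy : ∀ i k : ℕ, y (i + 1) * q ^ k ≠ 1) (lam : YoungDiagram) : cNormSq q y lam ≠ 0 :=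
  Finset.prod_ne_zero_iff.2 fun i _ =>
    div_ne_zero (qPoch_ne_zero (hy i) _) (qPoch_self_ne_zero q hq _)

theorem powParts_ne_zero {y : ℕ → K} (hy : ∀ i, y i ≠ 0) (lam : YoungDiagram) :
    powParts y lam ≠ 0 :=
  Finset.prod_ne_zero_iff.2 fun i _ => pow_ne_zero _ (hy i)

theorem hsWeightSq_zero (q x y : K) (hx : x ≠ 1) : hsWeightSq q x y 0 0 0 0 = 1 := by
  have h : 1 - x ≠ 0 := sub_ne_zero.2 hx.symm
  simp [hsWeightSq, h]

theorem hsWeightSq_zero_zero (q x y : K) (i : ℕ) :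
    hsWeightSq q x y i 0 i 0 = (1 - x * q ^ i) / (1 - x) := if_pos rfl

theorem hsWeightSq_zero_one (q x y : K) (i : ℕ) :
    hsWeightSq q x y (i + 1) 0 i 1 = (q ^ (i + 1) - 1) * x / (1 - x) := if_pos rfl

theorem hsWeightSq_one_zero (q x y : K) (i : ℕ) :
    hsWeightSq q x y i 1 (i + 1) 0 = (1 - y * q ^ i) / (1 - x) := if_pos rfl

theorem hsWeightSq_one_one (q x y : K) (i : ℕ) :
    hsWeightSq q x y i 1 i 1 = (y * q ^ i - x) / (1 - x) := if_pos rfl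

theorem hsWeightSq_left_le {q x y : K} {i j k l : ℕ} (h : hsWeightSq q x y i j k l ≠ 0) :
    j ≤ 1 := by
  by_contra! hc
  obtain ⟨j, rfl⟩ := Nat.exists_eq_add_of_le hc
  apply h
  rw [show Nat.succ 1 + j = j + 2 by omega]
  unfold hsWeightSq
  split_ifs
  · rcases l with _ | _ | l <;> rfl
  · rfl

theorem hsWeightSq_of_ne (q x y : K) {i j k l : ℕ} (h : i + j ≠ k + l) :
    hsWeightSq q x y i j k l = 0 := if_neg h

theorem qHahnWeightPoly_zero (q κ p σ : K) : qHahnWeightPoly q κ p σ 0 0 0 0 = 1 := by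
  simp [qHahnWeightPoly, qPoch, qPochHom]

theorem qHahnWeightPoly_of_ne (q κ p σ : K) {i j k l : ℕ} (h : i + j ≠ k + l) :
    qHahnWeightPoly q κ p σ i j k l = 0 := if_neg fun hc => h hc.1

theorem qHahnWeightPoly_right_le {q κ p σ : K} {i j k l : ℕ}
    (h : qHahnWeightPoly q κ p σ i j k l ≠ 0) : l ≤ i := by
  by_contra hc
  exact h (if_neg fun hh => hc hh.2)

theorem hlKernel_ne_zero {q u : K} {p r : ℕ → K} {lam nu : YoungDiagram}
    (h : hlKernel q u p r lam nu ≠ 0) :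
    nu ≤ lam ∧ ∀ i, lam.rowLen i ≤ nu.rowLen i + 1 := by
  have hle := isLower_rowKernel _ _ _ _ h
  refine ⟨hle, fun i => ?_⟩
  by_cases hi : i < lam.colLen 0
  · rw [hlKernel, rowKernel, if_pos hle] at h
    have := hsWeightSq_left_le
      (Finset.prod_ne_zero_iff.1 (right_ne_zero_of_mul h) i (Finset.mem_range.2 hi))
    omega
  · rw [(rowLen_eq_zero_iff lam i).2 (by omega)]
    exact Nat.zero_le _

theorem qwKernel_ne_zero {q κ : K} {p r : ℕ → K} {lam mu : YoungDiagram}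
    (h : qwKernel q κ p r lam mu ≠ 0) :
    mu ≤ lam ∧ ∀ i, lam.rowLen (i + 1) ≤ mu.rowLen i := by
  have hle := isLower_rowKernel _ _ _ _ h
  refine ⟨hle, fun i => ?_⟩
  by_cases hi : i < lam.colLen 0
  · rw [qwKernel, rowKernel, if_pos hle] at h
    have h1 := qHahnWeightPoly_right_le
      (Finset.prod_ne_zero_iff.1 (right_ne_zero_of_mul h) i (Finset.mem_range.2 hi))
    have h2 := mu.rowLen_anti i (i + 1) (Nat.le_succ i)
    omega
  · rw [(rowLen_eq_zero_iff lam (i + 1)).2 (by omega)]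
    exact Nat.zero_le _

theorem qRatio_succ (q y : K) (hq : ∀ k : ℕ, 1 ≤ k → q ^ k ≠ 1) (n : ℕ) :
    qRatio q y (n + 1) * (1 - q ^ (n + 1)) = qRatio q y n * (1 - y * q ^ n) := by
  rw [qRatio, qRatio, qPoch_succ, qPoch_succ, ← pow_succ']
  have h1 := qPoch_self_ne_zero q hq n
  have h2 : 1 - q ^ (n + 1) ≠ 0 := sub_ne_zero.2 (hq _ (by omega)).symm
  field_simp

/-- Trading the ratio at the bottom label `i` for that at the top label `k` replaces `c_S(ν)` by
`c_S(λ)`, which cancels the denominator of the Whittaker factor. The power of `P` is split off to be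
absorbed by the gauge. -/
theorem hsWeightSq_left (q u P R : K) (hq : ∀ k : ℕ, 1 ≤ k → q ^ k ≠ 1) (hu : u * P ≠ 1)
    {i ε k ε' : ℕ} (h : i + ε = k + ε') (hε : ε ≤ 1) (hε' : ε' ≤ 1) :
    qRatio q (P * R) i * hsWeightSq q (u * P) (P * R) i ε k ε' * (1 - u * P) =
      qRatio q (P * R) k * leftW u P R ε ε' (q ^ k) * P ^ ε' := by
  have h1 : 1 - u * P ≠ 0 := sub_ne_zero.2 hu.symm
  interval_cases ε <;> interval_cases ε'
  · obtain rfl : i = k := by omega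
    rw [hsWeightSq_zero_zero, leftW, mul_assoc, div_mul_cancel₀ _ h1]
    ring
  · obtain rfl : i = k + 1 := by omega
    have h2 := qRatio_succ q (P * R) hq k
    rw [hsWeightSq_zero_one, leftW, mul_assoc, div_mul_cancel₀ _ h1]
    linear_combination (-P * u) * h2
  · obtain rfl : k = i + 1 := by omega
    have h2 := qRatio_succ q (P * R) hq i
    rw [hsWeightSq_one_zero, leftW, mul_assoc, div_mul_cancel₀ _ h1]
    linear_combination -h2
  · obtain rfl : i = k := by omega
    rw [hsWeightSq_one_one, leftW, mul_assoc, div_mul_cancel₀ _ h1]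
    ring

theorem hsWeightSq_right (q u P R : K) (hu : u * P ≠ 1)
    {i ε k ε' : ℕ} (h : i + ε = k + ε') (hε : ε ≤ 1) (hε' : ε' ≤ 1) :
    hsWeightSq q (u * P) (P * R) i ε k ε' * (1 - u * P) =
      rightW u P R ε ε' (q ^ i) * P ^ ε' := by
  have h1 : 1 - u * P ≠ 0 := sub_ne_zero.2 hu.symm
  interval_cases ε <;> interval_cases ε'
  · obtain rfl : i = k := by omega
    rw [hsWeightSq_zero_zero, rightW, div_mul_cancel₀ _ h1]
    ring
  · obtain rfl : i = k + 1 := by omega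
    rw [hsWeightSq_zero_one, rightW, div_mul_cancel₀ _ h1]
    ring
  · obtain rfl : k = i + 1 := by omega
    rw [hsWeightSq_one_zero, rightW, div_mul_cancel₀ _ h1]
    ring
  · obtain rfl : i = k := by omega
    rw [hsWeightSq_one_one, rightW, div_mul_cancel₀ _ h1]
    ring

/-- The ratio contributed by the shifted `c_S` cancels `(σ;q)_i` and `(q;q)_i` in the q-Hahn weight.
What remains factors into a part in `(x', m')` and a part in `(m, x')`; this separation is what
makes the one-variable sums chains of 2×2 matrices. -/
theorem qHahnWeightPoly_eq_mul (q κ P R : K) (hq : ∀ k : ℕ, 1 ≤ k → q ^ k ≠ 1) (hP : P ≠ 0)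
    (hPR : ∀ k : ℕ, P * R * q ^ k ≠ 1) {m m' x' j k : ℕ} (hm : m' ≤ m) (hx : m' ≤ x')
    (h : m - m' + j = k + (x' - m')) :
    qRatio q (P * R) (m - m') * qHahnWeightPoly q κ P (P * R) (m - m') j k (x' - m') =
      R ^ (x' - m') * (hF q κ P x' m' * hG q κ R m x') := by
  have h1 := qPoch_self_ne_zero q hq (m - m')
  have h2 := qPoch_ne_zero hPR (m - m')
  rw [qHahnWeightPoly, hF, hG, if_pos hx, qRatio]
  by_cases hc : x' ≤ m
  · have h3 := qPoch_self_ne_zero q hq (m - x')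
    have h4 := qPoch_self_ne_zero q hq (x' - m')
    rw [if_pos ⟨h, by omega⟩, if_pos hc, show m - m' - (x' - m') = m - x' by omega,
      show P * R / P = R by field_simp, show κ * (P * R) / P = κ * R by field_simp]
    field_simp
  · rw [if_neg (by omega), if_neg hc]
    ring

theorem qwKernel_eq_prod (q κ : K) (p r : ℕ → K) (hq : ∀ k : ℕ, 1 ≤ k → q ^ k ≠ 1)
    (hp : ∀ i, p i ≠ 0) (hr : ∀ i, r i ≠ 0)
    (hpr : ∀ i k : ℕ, p (i + 2) * r (i + 1) * q ^ k ≠ 1) (lam mu : YoungDiagram) (L : ℕ)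
    (hlam : lam.colLen 0 ≤ L) (hmu : mu.colLen 0 ≤ L) :
    cNormSq q (fun i => p (i + 1) * r i) mu * qwKernel q κ p r lam mu =
      (∏ c ∈ Finset.range (L + 1), r c ^ lam.rowLen c / r c ^ mu.rowLen c) *
        (hF q κ (p 1) (lam.rowLen 0) (mu.rowLen 0) *
          ∏ c ∈ Finset.range L, (hF q κ (p (c + 2)) (lam.rowLen (c + 1)) (mu.rowLen (c + 1)) *
            hG q κ (r (c + 1)) (mu.rowLen c) (lam.rowLen (c + 1)))) := by
  by_cases hle : mu ≤ lam
  · have hle' := (le_iff_rowLen_le _ _).1 hle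
    rw [cNormSq_eq_prod q _ mu L hmu, qwKernel,
      rowKernel_of_le _ _ (fun c => qHahnWeightPoly_zero _ _ _ _) lam mu hle L hlam,
      mul_left_comm, ← Finset.prod_mul_distrib]
    have h1 : ∀ c, r c ^ lam.rowLen c / r c ^ mu.rowLen c = r c ^ (lam.rowLen c - mu.rowLen c) := by
      intro c
      rw [pow_sub₀ _ (hr c) (hle' c), div_eq_mul_inv]
    simp only [h1]
    rw [Finset.prod_range_succ', hF, if_pos (hle' 0)]
    have h2 : ∀ c ∈ Finset.range L,
        qRatio q (p (c + 1 + 1) * r (c + 1)) (mu.rowLen c - mu.rowLen (c + 1)) *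
          qHahnWeightPoly q κ (p (c + 2)) (p (c + 2) * r (c + 1))
            (mu.rowLen c - mu.rowLen (c + 1)) (lam.rowLen c - mu.rowLen c)
            (lam.rowLen c - lam.rowLen (c + 1)) (lam.rowLen (c + 1) - mu.rowLen (c + 1)) =
        r (c + 1) ^ (lam.rowLen (c + 1) - mu.rowLen (c + 1)) *
          (hF q κ (p (c + 2)) (lam.rowLen (c + 1)) (mu.rowLen (c + 1)) *
            hG q κ (r (c + 1)) (mu.rowLen c) (lam.rowLen (c + 1))) := by
      intro c _
      have h3 := mu.rowLen_anti c (c + 1) (Nat.le_succ c)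
      have h4 := lam.rowLen_anti c (c + 1) (Nat.le_succ c)
      have h5 := hle' c
      have h6 := hle' (c + 1)
      exact qHahnWeightPoly_eq_mul q κ _ _ hq (hp _) (hpr c) h3 h6 (by omega)
    rw [Finset.prod_congr rfl h2, Finset.prod_mul_distrib]
    ring
  -- Without containment the right side vanishes as well: the factor `hF` at a row with `λ_i < μ_i`
  -- is zero.
  · rw [qwKernel, rowKernel, if_neg hle, mul_zero]
    symm
    rw [le_iff_rowLen_le] at hle
    push Not at hle
    obtain ⟨i, hi⟩ := hle
    have hiL : i < L := by
      by_contra hc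
      rw [(rowLen_eq_zero_iff mu i).2 (by omega)] at hi
      omega
    rcases i with _ | i
    · rw [hF_of_lt q κ (p 1) hi, zero_mul, mul_zero]
    · rw [Finset.prod_eq_zero (Finset.mem_range.2 (show i < L by omega)), mul_zero, mul_zero]
      rw [hF_of_lt q κ _ hi, zero_mul]

theorem hlKernel_eq_prod_left (q u : K) (p r : ℕ → K) (hq : ∀ k : ℕ, 1 ≤ k → q ^ k ≠ 1)
    (hu : ∀ i, u * p (i + 1) ≠ 1) (lam nu : YoungDiagram) (L : ℕ)
    (hlam : lam.colLen 0 ≤ L) (hnu : nu.colLen 0 ≤ L) (hle : nu ≤ lam)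
    (hle' : ∀ i, lam.rowLen i ≤ nu.rowLen i + 1) :
    cNormSq q (fun i => p i * r i) nu * hlKernel q u p r lam nu *
        ∏ c ∈ Finset.range L, (1 - u * p (c + 1)) =
      cNormSq q (fun i => p i * r i) lam * (-u) ^ (lam.rowLen 0 - nu.rowLen 0) *
        (∏ c ∈ Finset.range (L + 1), p c ^ (lam.rowLen c - nu.rowLen c)) *
        ∏ c ∈ Finset.range L, leftW u (p (c + 1)) (r (c + 1)) (lam.rowLen c - nu.rowLen c)
          (lam.rowLen (c + 1) - nu.rowLen (c + 1)) (q ^ (lam.rowLen c - lam.rowLen (c + 1))) := by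
  have hle0 := (le_iff_rowLen_le _ _).1 hle
  rw [cNormSq_eq_prod q _ nu L hnu, cNormSq_eq_prod q _ lam L hlam, hlKernel,
    rowKernel_of_le _ _ (fun c => hsWeightSq_zero _ _ _ (hu c)) lam nu hle L hlam,
    Finset.prod_range_succ', mul_left_comm, mul_assoc, ← Finset.prod_mul_distrib,
    ← Finset.prod_mul_distrib]
  have h2 : ∀ c ∈ Finset.range L,
      qRatio q (p (c + 1) * r (c + 1)) (nu.rowLen c - nu.rowLen (c + 1)) *
        hsWeightSq q (u * p (c + 1)) (p (c + 1) * r (c + 1))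
          (nu.rowLen c - nu.rowLen (c + 1)) (lam.rowLen c - nu.rowLen c)
          (lam.rowLen c - lam.rowLen (c + 1)) (lam.rowLen (c + 1) - nu.rowLen (c + 1)) *
        (1 - u * p (c + 1)) =
      qRatio q (p (c + 1) * r (c + 1)) (lam.rowLen c - lam.rowLen (c + 1)) *
        leftW u (p (c + 1)) (r (c + 1)) (lam.rowLen c - nu.rowLen c)
          (lam.rowLen (c + 1) - nu.rowLen (c + 1)) (q ^ (lam.rowLen c - lam.rowLen (c + 1))) *
        p (c + 1) ^ (lam.rowLen (c + 1) - nu.rowLen (c + 1)) := by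
    intro c _
    have h3 := nu.rowLen_anti c (c + 1) (Nat.le_succ c)
    have h4 := lam.rowLen_anti c (c + 1) (Nat.le_succ c)
    have h5 := hle0 c
    have h6 := hle0 (c + 1)
    have h7 := hle' c
    have h8 := hle' (c + 1)
    exact hsWeightSq_left q u _ _ hq (hu c) (by omega) (by omega) (by omega)
  rw [Finset.prod_congr rfl h2, Finset.prod_mul_distrib, Finset.prod_mul_distrib,
    ← neg_mul, mul_pow]
  ring

theorem hlKernel_eq_prod_right (q u : K) (p r : ℕ → K)
    (hu : ∀ i, u * p (i + 1) ≠ 1) (mu lam : YoungDiagram) (L : ℕ)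
    (hmu : mu.colLen 0 ≤ L) (hle : lam ≤ mu) (hle' : ∀ i, mu.rowLen i ≤ lam.rowLen i + 1) :
    hlKernel q u p r mu lam * ∏ c ∈ Finset.range L, (1 - u * p (c + 1)) =
      (-u) ^ (mu.rowLen 0 - lam.rowLen 0) *
        (∏ c ∈ Finset.range (L + 1), p c ^ (mu.rowLen c - lam.rowLen c)) *
        ∏ c ∈ Finset.range L, rightW u (p (c + 1)) (r (c + 1)) (mu.rowLen c - lam.rowLen c)
          (mu.rowLen (c + 1) - lam.rowLen (c + 1)) (q ^ (lam.rowLen c - lam.rowLen (c + 1))) := by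
  have hle0 := (le_iff_rowLen_le _ _).1 hle
  rw [hlKernel,
    rowKernel_of_le _ _ (fun c => hsWeightSq_zero _ _ _ (hu c)) mu lam hle L hmu,
    Finset.prod_range_succ', mul_assoc, ← Finset.prod_mul_distrib]
  have h2 : ∀ c ∈ Finset.range L,
      hsWeightSq q (u * p (c + 1)) (p (c + 1) * r (c + 1))
          (lam.rowLen c - lam.rowLen (c + 1)) (mu.rowLen c - lam.rowLen c)
          (mu.rowLen c - mu.rowLen (c + 1)) (mu.rowLen (c + 1) - lam.rowLen (c + 1)) *
        (1 - u * p (c + 1)) =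
      rightW u (p (c + 1)) (r (c + 1)) (mu.rowLen c - lam.rowLen c)
          (mu.rowLen (c + 1) - lam.rowLen (c + 1)) (q ^ (lam.rowLen c - lam.rowLen (c + 1))) *
        p (c + 1) ^ (mu.rowLen (c + 1) - lam.rowLen (c + 1)) := by
    intro c _
    have h3 := lam.rowLen_anti c (c + 1) (Nat.le_succ c)
    have h4 := mu.rowLen_anti c (c + 1) (Nat.le_succ c)
    have h5 := hle0 c
    have h6 := hle0 (c + 1)
    have h7 := hle' c
    have h8 := hle' (c + 1)
    exact hsWeightSq_right q u _ _ (hu c) (by omega) (by omega) (by omega)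
  rw [Finset.prod_congr rfl h2, Finset.prod_mul_distrib, ← neg_mul, mul_pow]
  ring

/-! ### The Cauchy identity in one variable -/

/-- The function `hlKernel`, conjugated by the monomials `S^{2λ}`. -/
noncomputable def hlGauged (q u : K) (p r y : ℕ → K) (lam mu : YoungDiagram) : K :=
  powParts y mu / powParts y lam * hlKernel q u p r lam mu

/-- The function `qwKernel`, multiplied by the quotient of the factors `c_S`. -/
noncomputable def qwGauged (q κ : K) (p r y y' : ℕ → K) (lam mu : YoungDiagram) : K :=
  cNormSq q y' mu / cNormSq q y lam * qwKernel q κ p r lam mu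

theorem hF_add_add (q κ P : K) (x m e : ℕ) : hF q κ P (x + e) (m + e) = hF q κ P x m := by
  simp only [hF, Nat.add_sub_add_right, Nat.add_le_add_iff_right]

theorem hG_add_add (q κ P : K) (x m e : ℕ) : hG q κ P (m + e) (x + e) = hG q κ P m x := by
  simp only [hG, Nat.add_sub_add_right, Nat.add_le_add_iff_right]

section OneVariable

variable {q κ u : K} {p r : ℕ → K}

/-- All dependence on `lam` is concentrated in the increments `λ_c - ν_c` entering the transfer
matrices. The prefactor depends on `mu` and `nu` only, and is the same as in `right_term`. -/
theorem left_term (hq : ∀ k : ℕ, 1 ≤ k → q ^ k ≠ 1) (hp : ∀ i, p i ≠ 0) (hr : ∀ i, r i ≠ 0)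
    (hpr : ∀ i k : ℕ, p (i + 1) * r (i + 1) * q ^ k ≠ 1)
    (hpr' : ∀ i k : ℕ, p (i + 2) * r (i + 1) * q ^ k ≠ 1)
    (hu : ∀ i, u * p (i + 1) ≠ 1) (lam mu nu : YoungDiagram) (L : ℕ)
    (hlam : lam.colLen 0 ≤ L) (hmu : mu.colLen 0 ≤ L) (hnu : nu.colLen 0 ≤ L) (hle : nu ≤ lam)
    (hle' : ∀ i, lam.rowLen i ≤ nu.rowLen i + 1) :
    hlGauged q u p r (fun i => p i * r i) lam nu *
        qwGauged q κ p r (fun i => p i * r i) (fun i => p (i + 1) * r i) lam mu *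
        (cNormSq q (fun i => p i * r i) nu * ∏ c ∈ Finset.range L, (1 - u * p (c + 1))) =
      (∏ c ∈ Finset.range (L + 1), r c ^ nu.rowLen c / r c ^ mu.rowLen c) *
        ((-u) ^ (lam.rowLen 0 - nu.rowLen 0) *
          hF q κ (p 1) (nu.rowLen 0 + (lam.rowLen 0 - nu.rowLen 0)) (mu.rowLen 0) *
          ∏ c ∈ Finset.range L, leftT q κ u (p (c + 1)) (p (c + 2)) (r (c + 1)) (nu.rowLen c)
            (nu.rowLen (c + 1)) (mu.rowLen c) (mu.rowLen (c + 1)) (lam.rowLen c - nu.rowLen c)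
            (lam.rowLen (c + 1) - nu.rowLen (c + 1))) := by
  have hle0 := (le_iff_rowLen_le _ _).1 hle
  have hadd : ∀ i, nu.rowLen i + (lam.rowLen i - nu.rowLen i) = lam.rowLen i := fun i => by
    have := hle0 i
    omega
  have h1 := qwKernel_eq_prod q κ p r hq hp hr hpr' lam mu L hlam hmu
  have h2 := hlKernel_eq_prod_left q u p r hq hu lam nu L hlam hnu hle hle'
  have hc : cNormSq q (fun i => p i * r i) lam ≠ 0 := cNormSq_ne_zero hq hpr lam
  have hT : ∏ c ∈ Finset.range L, leftT q κ u (p (c + 1)) (p (c + 2)) (r (c + 1)) (nu.rowLen c)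
            (nu.rowLen (c + 1)) (mu.rowLen c) (mu.rowLen (c + 1)) (lam.rowLen c - nu.rowLen c)
            (lam.rowLen (c + 1) - nu.rowLen (c + 1)) =
      (∏ c ∈ Finset.range L, leftW u (p (c + 1)) (r (c + 1)) (lam.rowLen c - nu.rowLen c)
          (lam.rowLen (c + 1) - nu.rowLen (c + 1)) (q ^ (lam.rowLen c - lam.rowLen (c + 1)))) *
      ∏ c ∈ Finset.range L, (hF q κ (p (c + 2)) (lam.rowLen (c + 1)) (mu.rowLen (c + 1)) *
            hG q κ (r (c + 1)) (mu.rowLen c) (lam.rowLen (c + 1))) := by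
    rw [← Finset.prod_mul_distrib]
    refine Finset.prod_congr rfl fun c _ => ?_
    rw [leftT, hadd c, hadd (c + 1), mul_assoc]
  -- With `S² = p r`, the conjugation contributes `(p r)^{ν - λ}`, which cancels `p^{λ - ν}` and
  -- turns `r^{λ - μ}` into `r^{ν - μ}`.
  have hgauge : powParts (fun i => p i * r i) nu / powParts (fun i => p i * r i) lam *
      (∏ c ∈ Finset.range (L + 1), p c ^ (lam.rowLen c - nu.rowLen c)) *
      (∏ c ∈ Finset.range (L + 1), r c ^ lam.rowLen c / r c ^ mu.rowLen c) =
      ∏ c ∈ Finset.range (L + 1), r c ^ nu.rowLen c / r c ^ mu.rowLen c := by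
    rw [powParts_eq_prod _ nu (L + 1) (by omega), powParts_eq_prod _ lam (L + 1) (by omega),
      ← Finset.prod_div_distrib, ← Finset.prod_mul_distrib, ← Finset.prod_mul_distrib]
    refine Finset.prod_congr rfl fun c _ => ?_
    have h3 := hp c
    have h4 := hr c
    have h5 : p c ^ lam.rowLen c = p c ^ nu.rowLen c * p c ^ (lam.rowLen c - nu.rowLen c) := by
      rw [← pow_add, hadd]
    rw [mul_pow, mul_pow, h5]
    field_simp
  rw [hT, hadd 0, ← hgauge, hlGauged, qwGauged]
  calc _ = powParts (fun i => p i * r i) nu / powParts (fun i => p i * r i) lam *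
        (cNormSq q (fun i => p (i + 1) * r i) mu * qwKernel q κ p r lam mu) *
        (cNormSq q (fun i => p i * r i) nu * hlKernel q u p r lam nu *
          ∏ c ∈ Finset.range L, (1 - u * p (c + 1))) / cNormSq q (fun i => p i * r i) lam := by ring
    _ = _ := by
      rw [h1, h2]
      field_simp

theorem right_term (hq : ∀ k : ℕ, 1 ≤ k → q ^ k ≠ 1) (hp : ∀ i, p i ≠ 0) (hr : ∀ i, r i ≠ 0)
    (hpr : ∀ i k : ℕ, p (i + 1) * r (i + 1) * q ^ k ≠ 1)
    (hpr' : ∀ i k : ℕ, p (i + 2) * r (i + 1) * q ^ k ≠ 1)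
    (hu : ∀ i, u * p (i + 1) ≠ 1) (lam mu nu : YoungDiagram) (L : ℕ)
    (hlam : lam.colLen 0 ≤ L) (hmu : mu.colLen 0 ≤ L) (hnu : nu.colLen 0 ≤ L) (hle : lam ≤ mu)
    (hle' : ∀ i, mu.rowLen i ≤ lam.rowLen i + 1) :
    qwGauged q κ p r (fun i => p i * r i) (fun i => p (i + 1) * r i) nu lam *
        hlGauged q u (fun i => p (i + 1)) r (fun i => p (i + 1) * r i) mu lam *
        (cNormSq q (fun i => p i * r i) nu * ∏ c ∈ Finset.range L, (1 - u * p (c + 2))) =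
      (∏ c ∈ Finset.range (L + 1), r c ^ nu.rowLen c / r c ^ mu.rowLen c) *
        ((-u) ^ (mu.rowLen 0 - lam.rowLen 0) *
          hF q κ (p 1) (nu.rowLen 0 + (mu.rowLen 0 - lam.rowLen 0)) (mu.rowLen 0) *
          ∏ c ∈ Finset.range L, rightT q κ u (p (c + 2)) (r (c + 1))
            (nu.rowLen (c + 1)) (mu.rowLen c) (mu.rowLen (c + 1)) (mu.rowLen c - lam.rowLen c)
            (mu.rowLen (c + 1) - lam.rowLen (c + 1))) := by
  have hle0 := (le_iff_rowLen_le _ _).1 hle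
  have hadd : ∀ i, mu.rowLen i = lam.rowLen i + (mu.rowLen i - lam.rowLen i) := fun i => by
    have := hle0 i
    omega
  have h1 := qwKernel_eq_prod q κ p r hq hp hr hpr' nu lam L hnu hlam
  have h2 := hlKernel_eq_prod_right q u (fun i => p (i + 1)) r (fun i => hu (i + 1)) mu lam L hmu
    hle hle'
  have hc : cNormSq q (fun i => p i * r i) nu ≠ 0 := cNormSq_ne_zero hq hpr nu
  have hT : ∏ c ∈ Finset.range L, rightT q κ u (p (c + 2)) (r (c + 1))
            (nu.rowLen (c + 1)) (mu.rowLen c) (mu.rowLen (c + 1)) (mu.rowLen c - lam.rowLen c)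
            (mu.rowLen (c + 1) - lam.rowLen (c + 1)) =
      (∏ c ∈ Finset.range L, rightW u (p (c + 2)) (r (c + 1)) (mu.rowLen c - lam.rowLen c)
          (mu.rowLen (c + 1) - lam.rowLen (c + 1)) (q ^ (lam.rowLen c - lam.rowLen (c + 1)))) *
      ∏ c ∈ Finset.range L, (hF q κ (p (c + 2)) (nu.rowLen (c + 1)) (lam.rowLen (c + 1)) *
            hG q κ (r (c + 1)) (lam.rowLen c) (nu.rowLen (c + 1))) := by
    rw [← Finset.prod_mul_distrib]
    refine Finset.prod_congr rfl fun c _ => ?_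
    have hf : hF q κ (p (c + 2)) (nu.rowLen (c + 1) + (mu.rowLen (c + 1) - lam.rowLen (c + 1)))
        (mu.rowLen (c + 1)) = hF q κ (p (c + 2)) (nu.rowLen (c + 1)) (lam.rowLen (c + 1)) := by
      conv_lhs => rw [hadd (c + 1)]
      rw [Nat.add_sub_cancel_left, hF_add_add]
    have hg : hG q κ (r (c + 1)) (mu.rowLen c)
        (nu.rowLen (c + 1) + (mu.rowLen c - lam.rowLen c)) =
        hG q κ (r (c + 1)) (lam.rowLen c) (nu.rowLen (c + 1)) := by
      conv_lhs => rw [hadd c]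
      rw [Nat.add_sub_cancel_left, hG_add_add]
    have he : mu.rowLen c + (mu.rowLen (c + 1) - lam.rowLen (c + 1)) -
        (mu.rowLen (c + 1) + (mu.rowLen c - lam.rowLen c)) =
        lam.rowLen c - lam.rowLen (c + 1) := by
      have h3 := hle0 c
      have h4 := hle0 (c + 1)
      omega
    rw [rightT, hf, hg, he, mul_assoc]
  have hf0 : hF q κ (p 1) (nu.rowLen 0 + (mu.rowLen 0 - lam.rowLen 0)) (mu.rowLen 0) =
      hF q κ (p 1) (nu.rowLen 0) (lam.rowLen 0) := by
    conv_lhs => rw [hadd 0]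
    rw [Nat.add_sub_cancel_left, hF_add_add]
  -- The same cancellation with shifted `p`: `(p r)^{λ - μ} p^{μ - λ} r^{ν - λ} = r^{ν - μ}`.
  have hgauge : powParts (fun i => p (i + 1) * r i) lam / powParts (fun i => p (i + 1) * r i) mu *
      (∏ c ∈ Finset.range (L + 1), p (c + 1) ^ (mu.rowLen c - lam.rowLen c)) *
      (∏ c ∈ Finset.range (L + 1), r c ^ nu.rowLen c / r c ^ lam.rowLen c) =
      ∏ c ∈ Finset.range (L + 1), r c ^ nu.rowLen c / r c ^ mu.rowLen c := by
    rw [powParts_eq_prod _ mu (L + 1) (by omega), powParts_eq_prod _ lam (L + 1) (by omega),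
      ← Finset.prod_div_distrib, ← Finset.prod_mul_distrib, ← Finset.prod_mul_distrib]
    refine Finset.prod_congr rfl fun c _ => ?_
    have h3 := hp (c + 1)
    have h4 := hr c
    have h5 : p (c + 1) ^ mu.rowLen c =
        p (c + 1) ^ lam.rowLen c * p (c + 1) ^ (mu.rowLen c - lam.rowLen c) := by
      rw [← pow_add, ← hadd]
    rw [mul_pow, mul_pow, h5]
    field_simp
  rw [hT, hf0, ← hgauge, hlGauged, qwGauged]
  calc _ = powParts (fun i => p (i + 1) * r i) lam / powParts (fun i => p (i + 1) * r i) mu *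
        (cNormSq q (fun i => p (i + 1) * r i) lam * qwKernel q κ p r nu lam) *
        (hlKernel q u (fun i => p (i + 1)) r mu lam *
          ∏ c ∈ Finset.range L, (1 - u * p (c + 2))) := by field_simp
    _ = _ := by
      rw [h1, h2]
      ring

/-- The extension of a finite sequence by zeros. -/
def extendZero {L : ℕ} (y : Fin (L + 1) → ℕ) (i : ℕ) : ℕ := if h : i < L + 1 then y ⟨i, h⟩ else 0

theorem extendZero_apply {L : ℕ} (y : Fin (L + 1) → ℕ) (i : Fin (L + 1)) :
    extendZero y i = y i := dif_pos i.2

theorem extendZero_of_lt {L : ℕ} (y : Fin (L + 1) → ℕ) {i : ℕ} (h : L < i) :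
    extendZero y i = 0 := dif_neg (by omega)

theorem extendZero_le_one {L : ℕ} {y : Fin (L + 1) → ℕ}
    (hy : y ∈ Fintype.piFinset (fun _ : Fin (L + 1) => Finset.range 2)) (i : ℕ) :
    extendZero y i ≤ 1 := by
  by_cases h : i < L + 1
  · have := Finset.mem_range.1 (Fintype.mem_piFinset.1 hy ⟨i, h⟩)
    rw [extendZero, dif_pos h]
    omega
  · rw [extendZero_of_lt y (by omega)]
    exact Nat.zero_le _

theorem prod_fin_chain (T : ℕ → ℕ → ℕ → K) (L : ℕ) (y : Fin (L + 1) → ℕ) :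
    ∏ c : Fin L, T c (y c.castSucc) (y c.succ) =
      ∏ c ∈ Finset.range L, T c (extendZero y c) (extendZero y (c + 1)) := by
  rw [← Fin.prod_univ_eq_prod_range (fun c => T c (extendZero y c) (extendZero y (c + 1)))]
  refine Finset.prod_congr rfl fun c _ => ?_
  rw [← extendZero_apply y c.castSucc, ← extendZero_apply y c.succ, Fin.val_castSucc, Fin.val_succ]

theorem le_of_hF_ne_zero {P : K} {x m : ℕ} (h : hF q κ P x m ≠ 0) : m ≤ x := by
  by_contra hc
  exact h (if_neg hc)

theorem le_of_hG_ne_zero {R : K} {m x : ℕ} (h : hG q κ R m x ≠ 0) : x ≤ m := by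
  by_contra hc
  exact h (if_neg hc)

/-- The partitions `lam` correspond to their increments over `nu`. One column beyond `L` is taken
because `lam` may have length `L + 1`. In that column `hG` forces the last increment to be 0, as
`μ_{L+1} = 0` in the usual numbering of parts, so only `e 0` is seen and `e 1` is free. -/
theorem left_sum (hq : ∀ k : ℕ, 1 ≤ k → q ^ k ≠ 1) (hp : ∀ i, p i ≠ 0) (hr : ∀ i, r i ≠ 0)
    (hpr : ∀ i k : ℕ, p (i + 1) * r (i + 1) * q ^ k ≠ 1)
    (hpr' : ∀ i k : ℕ, p (i + 2) * r (i + 1) * q ^ k ≠ 1)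
    (hu : ∀ i, u * p (i + 1) ≠ 1) (mu nu : YoungDiagram) (L : ℕ)
    (hmu : mu.colLen 0 ≤ L) (hnu : nu.colLen 0 ≤ L) (e : ℕ → K) :
    (∑ᶠ lam, hlGauged q u p r (fun i => p i * r i) lam nu *
        qwGauged q κ p r (fun i => p i * r i) (fun i => p (i + 1) * r i) lam mu) *
        (cNormSq q (fun i => p i * r i) nu *
          ∏ c ∈ Finset.range (L + 1), (1 - u * p (c + 1))) * e 0 =
      (∏ c ∈ Finset.range (L + 1 + 1), r c ^ nu.rowLen c / r c ^ mu.rowLen c) *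
        ∑ ε ∈ Finset.range 2, (-u) ^ ε * hF q κ (p 1) (nu.rowLen 0 + ε) (mu.rowLen 0) *
          chainVec e (L + 1) (fun c => leftT q κ u (p (c + 1)) (p (c + 2)) (r (c + 1))
            (nu.rowLen c) (nu.rowLen (c + 1)) (mu.rowLen c) (mu.rowLen (c + 1))) ε := by
  rw [← sum_chain, Finset.mul_sum, mul_assoc, finsum_mul]
  have hmuL : mu.rowLen L = 0 := (rowLen_eq_zero_iff mu L).2 hmu
  -- The summand identity multiplied by the end vector; the last increment is 0 because `lam` has
  -- length at most `L + 1`.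
  have hval : ∀ lam : YoungDiagram, nu ≤ lam → (∀ i, lam.rowLen i ≤ nu.rowLen i + 1) →
      lam.colLen 0 ≤ L + 1 → _ := fun lam h1 h2 h3 => by
    have h := left_term (κ := κ) hq hp hr hpr hpr' hu lam mu nu (L + 1) h3 (by omega) (by omega)
      h1 h2
    have h4 : e (lam.rowLen (L + 1) - nu.rowLen (L + 1)) = e 0 := by
      rw [(rowLen_eq_zero_iff lam _).2 h3, Nat.zero_sub]
    rw [← Fin.prod_univ_eq_prod_range (fun c => leftT q κ u (p (c + 1)) (p (c + 2)) (r (c + 1))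
      (nu.rowLen c) (nu.rowLen (c + 1)) (mu.rowLen c) (mu.rowLen (c + 1))
      (lam.rowLen c - nu.rowLen c) (lam.rowLen (c + 1) - nu.rowLen (c + 1)))] at h
    exact (congrArg₂ (· * ·) h h4.symm)
  refine finsum_eq_sum_of_bij _ _ _ (fun lam i => lam.rowLen i - nu.rowLen i) ?_ ?_ ?_
  · intro lam hne
    obtain ⟨h1, h2⟩ := hlKernel_ne_zero
      (right_ne_zero_of_mul (left_ne_zero_of_mul (left_ne_zero_of_mul hne)))
    obtain ⟨-, h3⟩ := qwKernel_ne_zero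
      (right_ne_zero_of_mul (right_ne_zero_of_mul (left_ne_zero_of_mul hne)))
    have h4 : lam.colLen 0 ≤ L + 1 := by
      rw [← rowLen_eq_zero_iff]
      have := h3 L
      omega
    refine ⟨Fintype.mem_piFinset.2 fun i => Finset.mem_range.2 ?_, ?_⟩
    · have := h2 i
      omega
    · have h := hval lam h1 h2 h4
      simp only [mul_assoc] at h ⊢
      exact h.symm
  · intro lam lam' h h' heq
    obtain ⟨h1, -⟩ := hlKernel_ne_zero
      (right_ne_zero_of_mul (left_ne_zero_of_mul (left_ne_zero_of_mul h)))
    obtain ⟨-, h2⟩ := qwKernel_ne_zero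
      (right_ne_zero_of_mul (right_ne_zero_of_mul (left_ne_zero_of_mul h)))
    obtain ⟨h1', -⟩ := hlKernel_ne_zero
      (right_ne_zero_of_mul (left_ne_zero_of_mul (left_ne_zero_of_mul h')))
    obtain ⟨-, h2'⟩ := qwKernel_ne_zero
      (right_ne_zero_of_mul (right_ne_zero_of_mul (left_ne_zero_of_mul h')))
    refine eq_of_rowLen_eq fun i => ?_
    by_cases hi : i < L + 1 + 1
    · have h3 := congrFun heq ⟨i, hi⟩
      have h4 := (le_iff_rowLen_le _ _).1 h1 i
      have h5 := (le_iff_rowLen_le _ _).1 h1' i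
      dsimp only at h3
      omega
    · obtain ⟨j, rfl⟩ := Nat.exists_eq_add_of_le' (show 1 ≤ i by omega)
      have h3 := h2 j
      have h4 := h2' j
      have h5 := (rowLen_eq_zero_iff mu j).2 (by omega)
      omega
  · intro y hy hne
    have hne' := hne
    rw [prod_fin_chain (fun c => leftT q κ u (p (c + 1)) (p (c + 2)) (r (c + 1)) (nu.rowLen c)
      (nu.rowLen (c + 1)) (mu.rowLen c) (mu.rowLen (c + 1)))] at hne
    have hprod := right_ne_zero_of_mul (left_ne_zero_of_mul (right_ne_zero_of_mul hne))
    have h0 := le_of_hF_ne_zero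
      (right_ne_zero_of_mul (left_ne_zero_of_mul (left_ne_zero_of_mul (right_ne_zero_of_mul hne))))
    have hT : ∀ c < L + 1, mu.rowLen (c + 1) ≤ nu.rowLen (c + 1) + extendZero y (c + 1) ∧
        nu.rowLen (c + 1) + extendZero y (c + 1) ≤ mu.rowLen c := fun c hc => by
      have h1 := Finset.prod_ne_zero_iff.1 hprod c (Finset.mem_range.2 hc)
      exact ⟨le_of_hF_ne_zero (right_ne_zero_of_mul (left_ne_zero_of_mul h1)),
        le_of_hG_ne_zero (right_ne_zero_of_mul h1)⟩
    have hlow : ∀ i < L + 1 + 1, mu.rowLen i ≤ nu.rowLen i + extendZero y i := by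
      intro i hi
      rcases i with _ | i
      · exact h0
      · exact (hT i (by omega)).1
    -- The nonvanishing of `hF` and `hG` says that the new parts interlace with `mu`: `ν_{c+1} +
    -- ε_{c+1} ≤ μ_c ≤ ν_c + ε_c`. Hence they are decreasing.
    obtain ⟨lam, h1, h2⟩ := exists_rowLen_eq (fun i => nu.rowLen i + extendZero y i)
      (antitone_nat_of_succ_le fun i => by
        by_cases hi : i < L + 1
        · exact (hT i hi).2.trans (hlow i (by omega))
        · have h3 := (rowLen_eq_zero_iff nu (i + 1)).2 (by omega)
          have h4 := extendZero_of_lt y (show L + 1 < i + 1 by omega)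
          omega) (L + 1) (by
        have := (hT L (by omega)).2
        omega)
    have hy1 := extendZero_le_one hy
    have hphi : (fun i : Fin (L + 1 + 1) => lam.rowLen i - nu.rowLen i) = y := by
      funext i
      rw [h1, Nat.add_sub_cancel_left, extendZero_apply]
    have h := hval lam ((le_iff_rowLen_le _ _).2 fun i => by rw [h1]; omega)
      (fun i => by rw [h1]; have := hy1 i; omega) h2
    refine ⟨lam, ?_, hphi⟩
    subst hphi
    intro hzero
    refine hne' ?_
    simp only [mul_assoc] at h hzero ⊢
    exact h.symm.trans hzero

/-- Here `lam` corresponds to the boxes removed from `mu`. The transfer matrices do not forbid a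
removal from the empty last row, so this is excluded by `e 1 = 0`. -/
theorem right_sum (hq : ∀ k : ℕ, 1 ≤ k → q ^ k ≠ 1) (hp : ∀ i, p i ≠ 0) (hr : ∀ i, r i ≠ 0)
    (hpr : ∀ i k : ℕ, p (i + 1) * r (i + 1) * q ^ k ≠ 1)
    (hpr' : ∀ i k : ℕ, p (i + 2) * r (i + 1) * q ^ k ≠ 1)
    (hu : ∀ i, u * p (i + 1) ≠ 1) (mu nu : YoungDiagram) (L : ℕ)
    (hmu : mu.colLen 0 ≤ L) (hnu : nu.colLen 0 ≤ L) (e : ℕ → K) (he : e 1 = 0) :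
    (∑ᶠ lam, qwGauged q κ p r (fun i => p i * r i) (fun i => p (i + 1) * r i) nu lam *
        hlGauged q u (fun i => p (i + 1)) r (fun i => p (i + 1) * r i) mu lam) *
        (cNormSq q (fun i => p i * r i) nu *
          ∏ c ∈ Finset.range (L + 1), (1 - u * p (c + 2))) * e 0 =
      (∏ c ∈ Finset.range (L + 1 + 1), r c ^ nu.rowLen c / r c ^ mu.rowLen c) *
        ∑ ε ∈ Finset.range 2, (-u) ^ ε * hF q κ (p 1) (nu.rowLen 0 + ε) (mu.rowLen 0) *
          chainVec e (L + 1) (fun c => rightT q κ u (p (c + 2)) (r (c + 1))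
            (nu.rowLen (c + 1)) (mu.rowLen c) (mu.rowLen (c + 1))) ε := by
  rw [← sum_chain, Finset.mul_sum, mul_assoc, finsum_mul]
  have hmuL : mu.rowLen (L + 1) = 0 := (rowLen_eq_zero_iff mu _).2 (by omega)
  have hval : ∀ lam : YoungDiagram, lam ≤ mu → (∀ i, mu.rowLen i ≤ lam.rowLen i + 1) → _ :=
      fun lam h1 h2 => by
    have h := right_term (κ := κ) hq hp hr hpr hpr' hu lam mu nu (L + 1)
      ((colLen_mono h1).trans (by omega)) (by omega) (by omega) h1 h2
    have h4 : e (mu.rowLen (L + 1) - lam.rowLen (L + 1)) = e 0 := by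
      rw [hmuL, Nat.zero_sub]
    rw [← Fin.prod_univ_eq_prod_range (fun c => rightT q κ u (p (c + 2)) (r (c + 1))
            (nu.rowLen (c + 1)) (mu.rowLen c) (mu.rowLen (c + 1)) (mu.rowLen c - lam.rowLen c)
            (mu.rowLen (c + 1) - lam.rowLen (c + 1)))] at h
    exact (congrArg₂ (· * ·) h h4.symm)
  refine finsum_eq_sum_of_bij _ _ _ (fun lam i => mu.rowLen i - lam.rowLen i) ?_ ?_ ?_
  · intro lam hne
    obtain ⟨h1, h2⟩ := hlKernel_ne_zero
      (right_ne_zero_of_mul (right_ne_zero_of_mul (left_ne_zero_of_mul hne)))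
    refine ⟨Fintype.mem_piFinset.2 fun i => Finset.mem_range.2 ?_, ?_⟩
    · have := h2 i
      omega
    · have h := hval lam h1 h2
      simp only [mul_assoc] at h ⊢
      exact h.symm
  · intro lam lam' h h' heq
    obtain ⟨h1, -⟩ := hlKernel_ne_zero
      (right_ne_zero_of_mul (right_ne_zero_of_mul (left_ne_zero_of_mul h)))
    obtain ⟨h1', -⟩ := hlKernel_ne_zero
      (right_ne_zero_of_mul (right_ne_zero_of_mul (left_ne_zero_of_mul h')))
    refine eq_of_rowLen_eq fun i => ?_
    have h4 := (le_iff_rowLen_le _ _).1 h1 i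
    have h5 := (le_iff_rowLen_le _ _).1 h1' i
    by_cases hi : i < L + 1 + 1
    · have h3 := congrFun heq ⟨i, hi⟩
      dsimp only at h3
      omega
    · have h6 := (rowLen_eq_zero_iff mu i).2 (by omega)
      omega
  · intro y hy hne
    have hne' := hne
    rw [prod_fin_chain (fun c => rightT q κ u (p (c + 2)) (r (c + 1))
            (nu.rowLen (c + 1)) (mu.rowLen c) (mu.rowLen (c + 1)))] at hne
    have hprod := right_ne_zero_of_mul (left_ne_zero_of_mul (right_ne_zero_of_mul hne))
    have h0 := le_of_hF_ne_zero
      (right_ne_zero_of_mul (left_ne_zero_of_mul (left_ne_zero_of_mul (right_ne_zero_of_mul hne))))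
    have hlast := right_ne_zero_of_mul (right_ne_zero_of_mul hne)
    have hT : ∀ c < L + 1, mu.rowLen (c + 1) ≤ nu.rowLen (c + 1) + extendZero y (c + 1) ∧
        nu.rowLen (c + 1) + extendZero y c ≤ mu.rowLen c := fun c hc => by
      have h1 := Finset.prod_ne_zero_iff.1 hprod c (Finset.mem_range.2 hc)
      exact ⟨le_of_hF_ne_zero (right_ne_zero_of_mul (left_ne_zero_of_mul h1)),
        le_of_hG_ne_zero (right_ne_zero_of_mul h1)⟩
    have hy1 := extendZero_le_one hy
    have hyL : extendZero y (L + 1) = 0 := by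
      have h3 := extendZero_apply y (Fin.last (L + 1))
      rw [Fin.val_last] at h3
      have h4 := hy1 (L + 1)
      by_contra hc
      rw [← h3, show extendZero y (L + 1) = 1 by omega] at hlast
      exact hlast he
    have hle : ∀ i, extendZero y i ≤ mu.rowLen i := by
      intro i
      rcases lt_trichotomy i (L + 1) with hi | hi | hi
      · have := (hT i hi).2
        omega
      · rw [hi, hyL]
        exact Nat.zero_le _
      · rw [extendZero_of_lt y hi]
        exact Nat.zero_le _
    -- Again by interlacing, now with `nu`: `μ_{c+1} - ε_{c+1} ≤ ν_{c+1} ≤ μ_c - ε_c`.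
    obtain ⟨lam, h1, h2⟩ := exists_rowLen_eq (fun i => mu.rowLen i - extendZero y i)
      (antitone_nat_of_succ_le fun i => by
        by_cases hi : i < L + 1
        · have := hT i hi
          omega
        · have h3 := (rowLen_eq_zero_iff mu (i + 1)).2 (by omega)
          omega) (L + 1) (by omega)
    have hphi : (fun i : Fin (L + 1 + 1) => mu.rowLen i - lam.rowLen i) = y := by
      funext i
      rw [h1, Nat.sub_sub_self (hle i), extendZero_apply]
    have h := hval lam ((le_iff_rowLen_le _ _).2 fun i => by rw [h1]; omega)
      (fun i => by rw [h1]; have := hy1 i; omega)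
    refine ⟨lam, ?_, hphi⟩
    subst hphi
    intro hzero
    refine hne' ?_
    simp only [mul_assoc] at h hzero ⊢
    exact h.symm.trans hzero

/-- The skew dual Cauchy identity in one variable. -/
theorem isCauchy_one (hq : ∀ k : ℕ, 1 ≤ k → q ^ k ≠ 1) (hp : ∀ i, p i ≠ 0) (hr : ∀ i, r i ≠ 0)
    (hpr : ∀ i k : ℕ, p (i + 1) * r (i + 1) * q ^ k ≠ 1)
    (hpr' : ∀ i k : ℕ, p (i + 2) * r (i + 1) * q ^ k ≠ 1)
    (hu : ∀ i, u * p (i + 1) ≠ 1) :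
    IsCauchy ((1 - u * κ) / (1 - u * p 1)) (hlGauged q u p r fun i => p i * r i)
      (qwGauged q κ p r (fun i => p i * r i) fun i => p (i + 1) * r i)
      (hlGauged q u (fun i => p (i + 1)) r fun i => p (i + 1) * r i) := by
  intro nu mu
  let L := max (mu.colLen 0) (nu.colLen 0)
  have hmu : mu.colLen 0 ≤ L := le_max_left _ _
  have hnu : nu.colLen 0 ≤ L := le_max_right _ _
  have hne : ∀ i, 1 - u * p (i + 1) ≠ 0 := fun i => sub_ne_zero.2 (hu i).symm
  -- The right vector is `(1, 0)`; the left one is its image under the intertwiner at `n = m = 0`.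
  -- The entry `1 - q` is needed for the relation but never enters the left sum.
  have hbase : Intertwined q κ u (p (L + 1 + 1)) (nu.rowLen (L + 1)) (mu.rowLen (L + 1))
      (fun x => if x = 0 then 1 - u * p (L + 1 + 1) else 1 - q)
      (fun x => if x = 0 then 1 else 0) := by
    rw [(rowLen_eq_zero_iff nu _).2 (by omega), (rowLen_eq_zero_iff mu _).2 (by omega)]
    simp [Intertwined]
  have hchain := (intertwined_chain hq (L + 1) (fun c => p (c + 1)) (fun c => r (c + 1))
    nu.rowLen mu.rowLen _ _ hbase).left_sum hq
  have hl := left_sum (κ := κ) hq hp hr hpr hpr' hu mu nu L hmu hnu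
    (fun x => if x = 0 then 1 - u * p (L + 1 + 1) else 1 - q)
  have hr' := right_sum (κ := κ) hq hp hr hpr hpr' hu mu nu L hmu hnu
    (fun x => if x = 0 then 1 else 0) (by simp)
  rw [hchain] at hl
  simp only [if_true, mul_one] at hl hr'
  have hc : cNormSq q (fun i => p i * r i) nu ≠ 0 := cNormSq_ne_zero hq hpr nu
  have hprod : ∏ c ∈ Finset.range (L + 1), (1 - u * p (c + 2)) ≠ 0 :=
    Finset.prod_ne_zero_iff.2 fun c _ => hne (c + 1)
  -- The two denominators differ by a shift of `p`; the last factor is supplied by the value at 0 of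
  -- the left end vector, and `1 - u * p 1` survives.
  have hsplit : (∏ c ∈ Finset.range (L + 1), (1 - u * p (c + 1))) * (1 - u * p (L + 1 + 1)) =
      (∏ c ∈ Finset.range (L + 1), (1 - u * p (c + 2))) * (1 - u * p 1) := by
    rw [← Finset.prod_range_succ (fun c => 1 - u * p (c + 1)), Finset.prod_range_succ']
  have h1 := hne 0
  rw [zero_add] at h1
  refine mul_right_cancel₀ (mul_ne_zero (mul_ne_zero hc hprod) h1) ?_
  calc _ = (∑ᶠ lam, hlGauged q u p r (fun i => p i * r i) lam nu *
        qwGauged q κ p r (fun i => p i * r i) (fun i => p (i + 1) * r i) lam mu) *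
        (cNormSq q (fun i => p i * r i) nu * ∏ c ∈ Finset.range (L + 1), (1 - u * p (c + 1))) *
        (1 - u * p (L + 1 + 1)) := by
        rw [mul_assoc (cNormSq _ _ _), ← hsplit]
        ring
    _ = (1 - u * κ) * ((∑ᶠ lam,
        qwGauged q κ p r (fun i => p i * r i) (fun i => p (i + 1) * r i) nu lam *
        hlGauged q u (fun i => p (i + 1)) r (fun i => p (i + 1) * r i) mu lam) *
        (cNormSq q (fun i => p i * r i) nu *
          ∏ c ∈ Finset.range (L + 1), (1 - u * p (c + 2)))) := by
        rw [hl, hr']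
        ring
    _ = _ := by
        field_simp

end OneVariable

/-! ### The functions in several variables as compositions of kernels -/

/-- The extension of a finite family of variables by zeros. -/
def extendVars {n : ℕ} (x : Fin n → K) (i : ℕ) : K := if h : i < n then x ⟨i, h⟩ else 0

theorem extendVars_apply {n : ℕ} (x : Fin n → K) (i : Fin n) : extendVars x i = x i := dif_pos i.2

/-- Extending by zeros preserves genericity, so iteration may use kernels indexed by all natural
numbers. -/
theorem extendVars_mul_ne_one {m : ℕ} {u : Fin m → K} {x : K} (h : ∀ j, u j * x ≠ 1) (j : ℕ) :
    extendVars u j * x ≠ 1 := by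
  rw [extendVars]
  split_ifs with hj
  · exact h ⟨j, hj⟩
  · rw [zero_mul]
    exact zero_ne_one

/-- If the boundary labels balance, the two cutoffs are the same number; otherwise both sums vanish
by conservation. -/
theorem gridZ_edgeLabels {n L : ℕ} (w : Fin n → Fin L → ℕ → ℕ → ℕ → ℕ → K)
    (hw : ∀ r c i j k l, i + j ≠ k + l → w r c i j k l = 0) (a : Fin n → ℕ)
    (lam mu : YoungDiagram) (hlam : lam.colLen 0 ≤ L) (hmu : mu.colLen 0 ≤ L) :
    gridZ w a (edgeLabels mu L) (edgeLabels lam L) =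
      gridSum (lam.rowLen 0 + 1) w a (edgeLabels mu L) (edgeLabels lam L) := by
  rw [gridZ_eq_gridSum, sum_edgeLabels mu L hmu]
  by_cases h : ∑ r, a r + mu.rowLen 0 = lam.rowLen 0
  · rw [h]
  · rw [gridSum_eq_zero, gridSum_eq_zero] <;>
      first | exact hw | rwa [sum_edgeLabels mu L hmu, sum_edgeLabels lam L hlam]

theorem colLen_le_numCols (lam mu : YoungDiagram) :
    lam.colLen 0 ≤ numCols lam mu ∧ mu.colLen 0 ≤ numCols lam mu := by
  simp only [numCols]
  omega

/-- Row `k`, counted from 0, is the one-variable kernel with `p` shifted by `k` and `r` unchanged,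
since `s_{i+j} ξ_{i+j}` depends on the row and `s_j / ξ_j` does not. -/
theorem stochSpinQWhittaker_eq (q : K) (Ξ S : ℕ → K) {n : ℕ} (κ : Fin n → K)
    (lam mu : YoungDiagram) :
    stochSpinQWhittaker q Ξ S κ lam mu =
      kernelIter n (fun k => qwKernel q (extendVars κ k) (fun i => S (i + k) * Ξ (i + k))
        fun i => S i / Ξ i) lam mu := by
  obtain ⟨hlam, hmu⟩ := colLen_le_numCols lam mu
  have h := sum_gridSum_eq_kernelIter n (lam.rowLen 0 + 1) (numCols lam mu)
    (Finset.range (lam.rowLen 0 + 1))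
    (fun k a => (S 0 / Ξ 0) ^ a * qPochHom q (extendVars κ k) (S (1 + k) * Ξ (1 + k)) a /
      qPoch q q a)
    (fun k c => qHahnWeightPoly q (extendVars κ k) (S (c + 2 + k) * Ξ (c + 2 + k))
      (S (c + 2 + k) * Ξ (c + 2 + k) * (S (c + 1) / Ξ (c + 1))))
    (fun _ _ _ _ _ _ h => qHahnWeightPoly_of_ne _ _ _ _ h)
    (fun _ _ => qHahnWeightPoly_zero _ _ _ _)
    (fun _ _ _ _ h => Finset.mem_range.2 (by omega)) lam mu hlam hmu (Nat.lt_succ_self _)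
  refine Eq.trans ?_ h
  refine Finset.sum_congr rfl fun a _ => ?_
  have hgrid : ZW q Ξ S κ a lam mu = gridSum (lam.rowLen 0 + 1)
      (fun (r : Fin n) (c : Fin (numCols lam mu)) =>
        qHahnWeightPoly q (extendVars κ r) (S (c + 2 + r) * Ξ (c + 2 + r))
          (S (c + 2 + r) * Ξ (c + 2 + r) * (S (c + 1) / Ξ (c + 1)))) a
      (edgeLabels mu (numCols lam mu)) (edgeLabels lam (numCols lam mu)) := by
    rw [ZW, gridZ_edgeLabels _ (fun _ _ _ _ _ _ h => qHahnWeightPoly_of_ne _ _ _ _ h) a lam mu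
      hlam hmu]
    congr 1
    funext r c
    rw [extendVars_apply, show (r : ℕ) + 1 + ((c : ℕ) + 1) = c + 2 + r by omega, mul_div_assoc]
  rw [← hgrid]
  simp only [extendVars_apply, add_comm 1]
  -- The restriction on the sum of the left labels is automatic: off balance the grid sum is zero.
  split_ifs with hsum
  · rfl
  · rw [hgrid, gridSum_eq_zero, mul_zero]
    · exact fun _ _ _ _ _ _ h => qHahnWeightPoly_of_ne _ _ _ _ h
    · rw [sum_edgeLabels mu _ hmu, sum_edgeLabels lam _ hlam]
      omega

/-- The parameters enter only through `S Ξ` and `S²`, so the same statement applies to the original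
and to the mixed-shifted sequences. -/
theorem stochStableHL_eq (q : K) (Ξ S p r : ℕ → K) (hp : ∀ i, S i * Ξ i = p i)
    (hr : ∀ i, S i ^ 2 = p i * r i) {m : ℕ} (u : Fin m → K)
    (hu : ∀ j i, u j * p (i + 1) ≠ 1) (lam mu : YoungDiagram) :
    stochStableHL q Ξ S u lam.transpose mu.transpose =
      kernelIter m (fun j => hlKernel q (extendVars u j) p r) lam mu := by
  obtain ⟨hlam, hmu⟩ := colLen_le_numCols lam mu
  have h := sum_gridSum_eq_kernelIter m (lam.rowLen 0 + 1) (numCols lam mu)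
    (Finset.range 2) (fun j a => (-(extendVars u j * p 0)) ^ a)
    (fun j c => hsWeightSq q (extendVars u j * p (c + 1)) (p (c + 1) * r (c + 1)))
    (fun _ _ _ _ _ _ h => hsWeightSq_of_ne _ _ _ h)
    (fun j c => hsWeightSq_zero _ _ _ (extendVars_mul_ne_one (fun j => hu j c) j))
    (fun j lam mu h _ => by
      have h1 := (hlKernel_ne_zero h).2 0
      exact Finset.mem_range.2 (by omega)) lam mu hlam hmu (Nat.lt_succ_self _)
  refine Eq.trans ?_ h
  rw [stochStableHL, YoungDiagram.transpose_transpose, YoungDiagram.transpose_transpose]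
  refine Finset.sum_congr rfl fun a _ => ?_
  rw [Zw, gridZ_edgeLabels _ (fun _ _ _ _ _ _ h => by
    rw [hsWeight_eq]; exact hsWeightSq_of_ne _ _ _ h) a lam mu hlam hmu]
  congr 1
  · refine Finset.prod_congr rfl fun j _ => ?_
    rw [extendVars_apply, ← hp]
    ring
  · congr 1
    funext j c
    rw [hsWeight_eq, extendVars_apply, hr, ← hp]
    congr 1
    ring

/-! ### Supports of the normalized kernels and removal of the prefactors. -/

theorem rowBounded_hlGauged (q u : K) (p r y : ℕ → K) : RowBounded (hlGauged q u p r y) :=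
  ⟨1, fun _ _ h => (hlKernel_ne_zero (right_ne_zero_of_mul h)).2 0⟩

theorem isLower_hlGauged (q u : K) (p r y : ℕ → K) : IsLower (hlGauged q u p r y) :=
  fun _ _ h => (hlKernel_ne_zero (right_ne_zero_of_mul h)).1

theorem isLower_qwGauged (q κ : K) (p r y y' : ℕ → K) : IsLower (qwGauged q κ p r y y') :=
  fun _ _ h => (qwKernel_ne_zero (right_ne_zero_of_mul h)).1

theorem colBounded_qwGauged (q κ : K) (p r y y' : ℕ → K) : ColBounded (qwGauged q κ p r y y') := by
  refine ⟨1, fun lam mu h => ?_⟩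
  rw [← rowLen_eq_zero_iff]
  have h1 := (qwKernel_ne_zero (right_ne_zero_of_mul h)).2 (mu.colLen 0)
  have h2 := (rowLen_eq_zero_iff mu (mu.colLen 0)).2 le_rfl
  omega

theorem negPow_mul_self (S y : ℕ → K) (hy : ∀ i, S i ^ 2 = y i) (lam : YoungDiagram) :
    negPow S lam * negPow S lam = powParts y lam := by
  rw [negPow, powParts, ← Finset.prod_mul_distrib]
  refine Finset.prod_congr rfl fun i _ => ?_
  rw [← mul_pow, ← hy]
  ring

theorem negPow_ne_zero {S : ℕ → K} (hS : ∀ i, S i ≠ 0) (lam : YoungDiagram) : negPow S lam ≠ 0 :=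
  Finset.prod_ne_zero_iff.2 fun i _ => pow_ne_zero _ (neg_ne_zero.2 (hS i))

theorem cNorm_eq (q : K) (S y : ℕ → K) (hy : ∀ i, S i ^ 2 = y i) (lam : YoungDiagram) :
    cNorm q S lam = cNormSq q y lam := by
  simp only [cNorm, cNormSq, qRatio, hy]

/-- The factors `c_S` cancel by duality. The prefactor `(-S)^ν / (-S)^λ` is rewritten as its inverse
times `S^{2ν} / S^{2λ}`; the latter is the telescoped gauge of the composition. -/
theorem dualStableHL_eq (q : K) (Ξ S p r : ℕ → K) (hq : ∀ k : ℕ, 1 ≤ k → q ^ k ≠ 1)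
    (hS : ∀ i, S i ≠ 0) (hp : ∀ i, S i * Ξ i = p i) (hr : ∀ i, S i ^ 2 = p i * r i)
    (hpr : ∀ i k : ℕ, p (i + 1) * r (i + 1) * q ^ k ≠ 1) {m : ℕ} (u : Fin m → K)
    (hu : ∀ j i, u j * p (i + 1) ≠ 1) (lam nu : YoungDiagram) :
    dualStableHL q Ξ S u lam.transpose nu.transpose = negPow S lam / negPow S nu *
      kernelIter m (fun j => hlGauged q (extendVars u j) p r fun i => p i * r i) lam nu := by
  have hgauge := kernelIter_gauge m (fun j => hlKernel q (extendVars u j) p r)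
    (fun _ => powParts fun i => p i * r i)
    (fun _ _ lam => powParts_ne_zero (fun i => by rw [← hr]; exact pow_ne_zero _ (hS i)) lam)
    lam nu
  have hc : ∀ lam, cNorm q S lam ≠ 0 := fun lam => by
    rw [cNorm_eq q S _ hr]
    exact cNormSq_ne_zero hq hpr lam
  have h1 := hc lam
  have h2 := hc nu
  have h3 := negPow_ne_zero hS lam
  have h4 := negPow_ne_zero hS nu
  have hiter : kernelIter m (fun j => hlGauged q (extendVars u j) p r fun i => p i * r i) lam nu =
    powParts (fun i => p i * r i) nu / powParts (fun i => p i * r i) lam *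
      kernelIter m (fun j => hlKernel q (extendVars u j) p r) lam nu := hgauge
  rw [dualStableHL, stableHL, stochStableHL_eq q Ξ S p r hp hr u hu, hiter,
    ← negPow_mul_self S _ hr, ← negPow_mul_self S _ hr]
  simp only [YoungDiagram.transpose_transpose]
  field_simp

/-- The factors `c` of the successive shifts of `S` are inserted at the intermediate partitions and
telescope to the outer two. This needs them nonzero for every shift from 0 to `n`. -/
theorem spinQWhittaker_eq (q : K) (Ξ S rΞ rS : ℕ → K) {n : ℕ} (κ : Fin n → K)
    (hq : ∀ k : ℕ, 1 ≤ k → q ^ k ≠ 1)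
    (hsq : ∀ i, S i ^ 2 = S i * Ξ i * (S i / Ξ i))
    (hmix : ∀ i, mixedShift n rS rΞ i ^ 2 = S (i + n) * Ξ (i + n) * (S i / Ξ i))
    (hsing : ∀ k ≤ n, ∀ i l : ℕ,
      S (i + 1 + k) * Ξ (i + 1 + k) * (S (i + 1) / Ξ (i + 1)) * q ^ l ≠ 1)
    (lam mu : YoungDiagram) :
    spinQWhittaker q Ξ S rΞ rS κ lam mu = negPow (mixedShift n rS rΞ) mu / negPow S lam *
      kernelIter n (fun k => qwGauged q (extendVars κ k) (fun i => S (i + k) * Ξ (i + k))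
        (fun i => S i / Ξ i) (fun i => S (i + k) * Ξ (i + k) * (S i / Ξ i))
        fun i => S (i + (k + 1)) * Ξ (i + (k + 1)) * (S i / Ξ i)) lam mu := by
  have hgauge := kernelIter_gauge n
    (fun k => qwKernel q (extendVars κ k) (fun i => S (i + k) * Ξ (i + k)) fun i => S i / Ξ i)
    (fun k => cNormSq q fun i => S (i + k) * Ξ (i + k) * (S i / Ξ i))
    (fun k hk lam => cNormSq_ne_zero hq (fun i l => hsing k hk i l) lam) lam mu
  rw [spinQWhittaker, stochSpinQWhittaker_eq, cNorm_eq q _ _ hmix, cNorm_eq q _ _ hsq, mul_assoc]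
  congr 1
  exact hgauge.symm

theorem isCauchy_iter (q : K) (Ξ S : ℕ → K) {n m : ℕ} (κ : Fin n → K) (u : Fin m → K)
    (hq : ∀ k : ℕ, 1 ≤ k → q ^ k ≠ 1) (hΞ : ∀ i, Ξ i ≠ 0) (hS : ∀ i, S i ≠ 0)
    (hsing : ∀ k ≤ n, ∀ i l : ℕ,
      S (i + 1 + k) * Ξ (i + 1 + k) * (S (i + 1) / Ξ (i + 1)) * q ^ l ≠ 1)
    (hu : ∀ j i, u j * (S (i + 1) * Ξ (i + 1)) ≠ 1) :
    IsCauchy (∏ i : Fin n, ∏ j : Fin m, (1 - u j * κ i) / (1 - u j * Ξ (i + 1) * S (i + 1)))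
      (kernelIter m fun j => hlGauged q (extendVars u j) (fun i => S i * Ξ i)
        (fun i => S i / Ξ i) fun i => S i * Ξ i * (S i / Ξ i))
      (kernelIter n fun k => qwGauged q (extendVars κ k) (fun i => S (i + k) * Ξ (i + k))
        (fun i => S i / Ξ i) (fun i => S (i + k) * Ξ (i + k) * (S i / Ξ i))
        fun i => S (i + (k + 1)) * Ξ (i + (k + 1)) * (S i / Ξ i))
      (kernelIter m fun j => hlGauged q (extendVars u j) (fun i => S (i + n) * Ξ (i + n))
        (fun i => S i / Ξ i) fun i => S (i + n) * Ξ (i + n) * (S i / Ξ i)) := by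
  have hconst : ∏ i : Fin n, ∏ j : Fin m,
      (1 - u j * κ i) / (1 - u j * Ξ (i + 1) * S (i + 1)) =
      ∏ j ∈ Finset.range m, ∏ k ∈ Finset.range n, (1 - extendVars u j * extendVars κ k) /
        (1 - extendVars u j * (S (1 + k) * Ξ (1 + k))) := by
    rw [Finset.prod_comm, ← Fin.prod_univ_eq_prod_range (fun j => ∏ k ∈ Finset.range n,
      (1 - extendVars u j * extendVars κ k) / (1 - extendVars u j * (S (1 + k) * Ξ (1 + k))))]
    refine Finset.prod_congr rfl fun j _ => ?_
    rw [← Fin.prod_univ_eq_prod_range (fun k =>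
      (1 - extendVars u j * extendVars κ k) / (1 - extendVars u j * (S (1 + k) * Ξ (1 + k))))]
    refine Finset.prod_congr rfl fun k _ => ?_
    rw [extendVars_apply, extendVars_apply, add_comm 1 (k : ℕ), mul_assoc, mul_comm (Ξ _)]
  rw [hconst]
  refine IsCauchy.iter_left m _ _ _ _ (fun j _ => ?_) (fun j => rowBounded_hlGauged _ _ _ _ _)
    (fun j => isLower_hlGauged _ _ _ _ _) (fun j => isLower_hlGauged _ _ _ _ _)
    (IsLower.iter n _ fun k => isLower_qwGauged _ _ _ _ _ _)
    (ColBounded.iter n _ fun k => colBounded_qwGauged _ _ _ _ _ _)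
  -- For a fixed `u` variable, each `κ` moves `p` one step further, ending at the shift by `n`.
  refine IsCauchy.iter_right n _
    (fun k => hlGauged q (extendVars u j) (fun i => S (i + k) * Ξ (i + k))
        (fun i => S i / Ξ i) fun i => S (i + k) * Ξ (i + k) * (S i / Ξ i)) _
    (fun k hk => ?_) (fun k => rowBounded_hlGauged _ _ _ _ _)
    (fun k => isLower_qwGauged _ _ _ _ _ _) (fun k => colBounded_qwGauged _ _ _ _ _ _)
  have h := isCauchy_one (q := q) (κ := extendVars κ k) (u := extendVars u j)
    (p := fun i => S (i + k) * Ξ (i + k)) (r := fun i => S i / Ξ i) hq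
    (fun i => mul_ne_zero (hS _) (hΞ _)) (fun i => div_ne_zero (hS _) (hΞ _))
    (fun i l => hsing k hk.le i l)
    (fun i l => by
      have h1 := hsing (k + 1) hk i l
      rwa [show i + 1 + (k + 1) = i + 2 + k by omega] at h1)
    (fun i => by
      have h1 := extendVars_mul_ne_one (fun j => hu j (i + k)) j
      rwa [show i + k + 1 = i + 1 + k by omega] at h1)
  have hshift : ∀ i, i + 1 + k = i + (k + 1) := fun i => by omega
  simp only [hshift] at h
  simp only [add_comm 1 k]
  simpa only [zero_add] using h

end SpinWhittaker

theorem mainTheorem2 {K : Type*} [Field K] (q : K) (Ξ S rΞ rS : ℕ → K)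
    (hrΞ : ∀ i, rΞ i ^ 2 = Ξ i) (hrS : ∀ i, rS i ^ 2 = S i)
    {n m : ℕ} (κ : Fin n → K) (u : Fin m → K)
    (hq : ∀ k : ℕ, 1 ≤ k → q ^ k ≠ 1)
    (hΞ : ∀ i, Ξ i ≠ 0) (hS : ∀ i, S i ≠ 0)
    (hsing : ∀ i j k : ℕ, i ≤ n → 1 ≤ j → S (i + j) * Ξ (i + j) * S j / Ξ j * q ^ k ≠ 1)
    (hu : ∀ (j : Fin m) (i : ℕ), 1 ≤ i → u j * Ξ i * S i ≠ 1)
    (mu nu : YoungDiagram) :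
    {lam : YoungDiagram |
        SpinWhittaker.dualStableHL q Ξ S u lam.transpose nu.transpose *
          SpinWhittaker.spinQWhittaker q Ξ S rΞ rS κ lam mu ≠ 0}.Finite ∧
    {lam : YoungDiagram |
        SpinWhittaker.spinQWhittaker q Ξ S rΞ rS κ nu lam *
          SpinWhittaker.dualStableHL q (SpinWhittaker.mixedShift n rΞ rS)
            (SpinWhittaker.mixedShift n rS rΞ) u mu.transpose lam.transpose ≠ 0}.Finite ∧
    ∑ᶠ lam : YoungDiagram,
        SpinWhittaker.dualStableHL q Ξ S u lam.transpose nu.transpose *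
          SpinWhittaker.spinQWhittaker q Ξ S rΞ rS κ lam mu =
      (∏ i : Fin n, ∏ j : Fin m,
          (1 - u j * κ i) / (1 - u j * Ξ (i + 1) * S (i + 1))) *
        ∑ᶠ lam : YoungDiagram,
          SpinWhittaker.spinQWhittaker q Ξ S rΞ rS κ nu lam *
            SpinWhittaker.dualStableHL q (SpinWhittaker.mixedShift n rΞ rS)
              (SpinWhittaker.mixedShift n rS rΞ) u mu.transpose lam.transpose := by
  open SpinWhittaker in
  have hrΞ0 : ∀ i, rΞ i ≠ 0 := fun i h => hΞ i (by rw [← hrΞ, h]; simp)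
  have hrS0 : ∀ i, rS i ≠ 0 := fun i h => hS i (by rw [← hrS, h]; simp)
  have hsq : ∀ i, S i ^ 2 = S i * Ξ i * (S i / Ξ i) := fun i => by
    have := hΞ i
    field_simp
  have hmix : ∀ i, mixedShift n rS rΞ i ^ 2 = S (i + n) * Ξ (i + n) * (S i / Ξ i) := fun i => by
    rw [mixedShift_sq n rS rΞ S Ξ hrS hrΞ, mul_div_assoc]
  -- The same chosen roots occur in both shifted sequences, so the product holds exactly and not
  -- merely up to sign.
  have hmix' : ∀ i, mixedShift n rS rΞ i * mixedShift n rΞ rS i = S (i + n) * Ξ (i + n) :=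
    fun i => by
      have h1 := hrΞ0 i
      have h2 := hrS0 i
      rw [mixedShift, mixedShift, ← hrS (i + n), ← hrΞ (i + n)]
      field_simp
  have hmix0 : ∀ i, mixedShift n rS rΞ i ≠ 0 := fun i =>
    div_ne_zero (mul_ne_zero (mul_ne_zero (hrS0 _) (hrΞ0 _)) (hrS0 _)) (hrΞ0 _)
  have hsing' : ∀ k ≤ n, ∀ i l : ℕ,
      S (i + 1 + k) * Ξ (i + 1 + k) * (S (i + 1) / Ξ (i + 1)) * q ^ l ≠ 1 := fun k hk i l => by
    have h := hsing k (i + 1) l hk (by omega)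
    rwa [add_comm k, mul_div_assoc] at h
  have hu' : ∀ j i, u j * (S (i + 1) * Ξ (i + 1)) ≠ 1 := fun j i => by
    have h := hu j (i + 1) (by omega)
    rwa [mul_assoc, mul_comm (Ξ _)] at h
  have hCauchy := isCauchy_iter q Ξ S κ u hq hΞ hS hsing' hu' nu mu
  have hB := spinQWhittaker_eq q Ξ S rΞ rS κ hq hsq hmix hsing'
  have hA := dualStableHL_eq q Ξ S (fun i => S i * Ξ i) (fun i => S i / Ξ i) hq hS (fun _ => rfl)
    hsq (fun i l => hsing' 0 (Nat.zero_le n) i l) u hu'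
  have hA' := dualStableHL_eq q (mixedShift n rΞ rS) (mixedShift n rS rΞ)
    (fun i => S (i + n) * Ξ (i + n)) (fun i => S i / Ξ i) hq hmix0 hmix' hmix
    (fun i l => hsing' n le_rfl i l) u (fun j i => by
      have h := hu' j (i + n)
      rwa [show i + n + 1 = i + 1 + n by omega] at h)
  have hneg := negPow_ne_zero hS
  have hneg' := negPow_ne_zero hmix0
  -- The monomials at the summed partition cancel, here `(-S)^λ` and in `hright` its shifted
  -- analogue. The same constant `(-τS)^μ / (-S)^ν` is left on both sides.
  have hleft : ∀ lam, dualStableHL q Ξ S u lam.transpose nu.transpose *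
      spinQWhittaker q Ξ S rΞ rS κ lam mu =
      negPow (mixedShift n rS rΞ) mu / negPow S nu * (kernelIter m _ lam nu * kernelIter n _ lam mu) := fun lam => by
    rw [hA, hB]
    have h1 := hneg lam
    rw [show ∀ a b c d e f : K, a / b * c * (d / e * f) = d / b * (a / e) * (c * f) by
      intros; ring, div_self h1, mul_one]
  have hright : ∀ lam, spinQWhittaker q Ξ S rΞ rS κ nu lam *
      dualStableHL q (mixedShift n rΞ rS) (mixedShift n rS rΞ) u mu.transpose lam.transpose =
      negPow (mixedShift n rS rΞ) mu / negPow S nu * (kernelIter n _ nu lam * kernelIter m _ mu lam) := fun lam => by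
    rw [hA', hB]
    have h1 := hneg' lam
    rw [show ∀ a b c d e f : K, a / b * c * (d / e * f) = d / b * (a / e) * (c * f) by
      intros; ring, div_self h1, mul_one]
  simp only [hleft, hright]
  refine ⟨?_, ?_, ?_⟩
  · refine (finite_support_left
      (RowBounded.iter m _ fun j => rowBounded_hlGauged _ _ _ _ _)
      (ColBounded.iter n _ fun k => colBounded_qwGauged _ _ _ _ _ _) nu mu).subset
      fun lam h => right_ne_zero_of_mul h
  · refine (finite_support_right
      (IsLower.iter n _ fun k => isLower_qwGauged _ _ _ _ _ _) nu mu).subset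
      fun lam h => right_ne_zero_of_mul h
  · rw [← mul_finsum, ← mul_finsum, hCauchy]
    ring
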